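/- **Conventions.** Let $G$ be a (finite-dimensional, Hausdorff) Lie group with Lie algebra $\mathfrak g$ of left-invariant vector fields. Complexes are cochain complexes of real vector spaces. Put $\Delta_k=\{1\ge t_1\ge\dots\ge t_k\ge 0\}\subset\mathbb R^k$ with vertices $v_i=(1,\dots,1,0,\dots,0)$ ($i$ ones), and $I=[0,1]$. The DG Lie algebra $\mathbb T\mathfrak g$ has elements $i_x$ in degree $-1$ and $L_x$ in degree $0$ (linear in $x\in\mathfrak g$), differential $d\,i_x=L_x$, and brackets $[L_x,L_y]=L_{[x,y]}$, $[L_x,i_y]=i_{[x,y]}$, $[i_x,i_y]=0$. $\mathbf{Rep}(\mathbb T\mathfrak g)$ is the category of its representations on finite-dimensional complexes (morphisms: equivariant morphisms of complexes), monoidal under $y(v\otimes w)=yv\otimes w+(-1)^{|y||v|}v\otimes yw$ for homogeneous $y\in\mathbb T\mathfrak g$. $C_\bullet(G)$ is the space of smooth singular chains, a $k$-chain having degree $-k$, with boundary $\sum_i(-1)^i\,\sigma|_{[v_0,\dots,\hat v_i,\dots,v_k]}$; with product the Eilenberg–Zilber shuffle map followed by multiplication in $G$, whose unit is the $0$-simplex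 at $1\in G$; with coproduct $\sigma\mapsto\sum_i\sigma|_{[v_0,\dots,v_i]}\otimes\sigma|_{[v_i,\dots,v_k]}$ and counit equal to $1$ on $0$-simplices and $0$ on other simplices. It acts on $V\otimes W$ through the coproduct, $(a\otimes b)(v\otimes w)=(-1)^{|b||v|}av\otimes bw$, and on the trivial module $\mathbb R$ through the counit. $\mathbf{Mod}(C_\bullet(G))$ is the category of left DG modules $\rho\colon C_\bullet(G)\to\operatorname{End}(V)$ such that (a) $V$ is finite-dimensional; (b) $\rho(\sigma)=0$ for every thin simplex $\sigma\colon\Delta_k\to G$, i.e. one whose differential has rank $<k$ at every point; (c) for every manifold $M$ and smooth $\sigma_M\colon M\times\Delta_k\to G$ the map $p\mapsto\rho(\sigma_M(p,-))$ is smooth; (d) the matrix coefficients $c$ of $\rho$ are alternating and subdivision invariant. For (d), put $\tau(c)(\theta)=\sum_{\chi\in\mathfrak S_k}\operatorname{sgn}(\chi)\,c(\theta\circ\chi_*|_{\Delta_k})$ for smooth $\theta\colon I^k\to G$, with $\chi_*(t)=(t_{\chi(1)},\dots,t_{\chi(k)})$. Then $c$ is alternating if $\tau(c)(\theta\circ\chi_*)=\operatorname{sgn}(\chi)\tau(c)(\theta)$,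 and subdivision invariant if $\tau(c)(\theta)=\sum_\sigma\operatorname{sgn}(\sigma)c(\theta\circ\sigma)$ for each affine triangulation of $I^k$ with finite totally ordered vertex set; here $\sigma$ runs over its $k$-simplices, $\sigma\colon\Delta_k\to I^k$ being the affine parametrization that respects the order of the vertices and $\operatorname{sgn}(\sigma)$ its orientation sign. Let $\mathbf{Mod}^{\otimes}(C_\bullet(G))$ be the full subcategory, of the monoidal category of complexes with a linear $C_\bullet(G)$-action, on the smallest class of objects that contains $\mathbf{Mod}(C_\bullet(G))$ and the trivial module $\mathbb R$ and is closed under tensor products. For $x\in\mathfrak g$ let $\sigma[x]$ be the $1$-simplex $s\mapsto\exp(sx)$. **Theorem.** 1. For each $\rho\colon C_\bullet(G)\to\operatorname{End}(V)$ in $\mathbf{Mod}(C_\bullet(G))$ there is a representation $\mathscr D(\rho)\colon\mathbb T\mathfrak g\to\operatorname{End}(V)$ on the same complex such that $$\mathscr D(\rho)(L_x)=\frac{d}{dt}\Big|_{t=0}\rho(\exp(tx)),\qquad \mathscr D(\rho)(i_x)=\frac{d}{dt}\Big|_{t=0}\rho(\sigma[tx])\qquad(x\in\mathfrak g);$$ in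 particular these derivatives exist. 2. Every morphism in $\mathbf{Mod}(C_\bullet(G))$ is a morphism of the corresponding representations, so that there is a functor $\mathscr D\colon\mathbf{Mod}(C_\bullet(G))\to\mathbf{Rep}(\mathbb T\mathfrak g)$ which is the identity on underlying complexes and maps. 3. $\mathscr D$ is monoidal: by the same formulas it extends to a functor $\mathbf{Mod}^{\otimes}(C_\bullet(G))\to\mathbf{Rep}(\mathbb T\mathfrak g)$, which is again the identity on underlying complexes and maps, and this functor is strong monoidal with the identity maps as structure isomorphisms. In particular, for $V,W\in\mathbf{Mod}(C_\bullet(G))$, differentiating the action of $C_\bullet(G)$ on $V\otimes W$ gives the representation $\mathscr D(V)\otimes\mathscr D(W)$. -/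

import Mathlib

open scoped Manifold ContDiff TensorProduct DirectSum
open CategoryTheory Set

noncomputable section
namespace LieChains
universe u

/-! ### Finite-dimensional cochain complexes -/

/-- A finite-dimensional cochain complex of real vector spaces: a finite-dimensional real vector
space with an internal `ℤ`-grading and a differential of degree `1`. -/
structure FinComplex : Type 1 where
  carrier : Type
  [addCommGroup : AddCommGroup carrier]
  [module : Module ℝ carrier]
  [finite : FiniteDimensional ℝ carrier]
  gr : ℤ → Submodule ℝ carrier
  isInternal : DirectSum.IsInternal gr
  d : Module.End ℝ carrier
  d_mem : ∀ (n : ℤ) (v : carrier), v ∈ gr n → d v ∈ gr (n + 1)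
  d_d : d * d = 0

attribute [instance] FinComplex.addCommGroup FinComplex.module FinComplex.finite

namespace FinComplex

instance (X : FinComplex) : DirectSum.Decomposition X.gr := X.isInternal.chooseDecomposition

/-- The sign operator `v ↦ (-1)^(p|v|) v`. -/
def sgn (X : FinComplex) (p : ℤ) : Module.End ℝ X.carrier :=
  (DirectSum.toModule ℝ ℤ X.carrier fun n => ((-1 : ℝ) ^ (p * n)) • (X.gr n).subtype) ∘ₗ
    (DirectSum.decomposeLinearEquiv X.gr).toLinearMap

lemma sgn_of_mem (X : FinComplex) (p : ℤ) {n : ℤ} {v : X.carrier} (hv : v ∈ X.gr n) :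
    X.sgn p v = ((-1 : ℝ) ^ (p * n)) • v := by
  have h := DirectSum.decompose_of_mem X.gr hv
  rw [sgn, LinearMap.comp_apply, LinearEquiv.coe_coe, DirectSum.decomposeLinearEquiv_apply, h,
    ← DirectSum.lof_eq_of ℝ, DirectSum.toModule_lof]
  simp

lemma hom_ext (X : FinComplex) {W : Type*} [AddCommGroup W] [Module ℝ W]
    {f g : X.carrier →ₗ[ℝ] W} (h : ∀ n, ∀ v ∈ X.gr n, f v = g v) : f = g := by
  ext v
  induction v using DirectSum.Decomposition.inductionOn X.gr with
  | zero => simp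
  | homogeneous m => exact h _ _ m.2
  | add a b ha hb => simp [ha, hb]

/-- The one-dimensional complex `ℝ` in degree `0`. -/
@[reducible] def unit : FinComplex where
  carrier := ℝ
  gr n := if n = 0 then ⊤ else ⊥
  isInternal := by
    rw [DirectSum.isInternal_submodule_iff_iSupIndep_and_iSup_eq_top]
    refine ⟨fun n => ?_, ?_⟩
    · dsimp only
      rcases eq_or_ne n 0 with rfl | hn
      · rw [iSup₂_eq_bot.2 fun j hj => if_neg hj]
        exact disjoint_bot_right
      · rw [if_neg hn]
        exact disjoint_bot_left
    · exact eq_top_iff.2 (le_iSup_of_le 0 (by simp))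
  d := 0
  d_mem := by simp
  d_d := by simp

variable (X Y : FinComplex)

/-- `(X ⊗ Y)^n = ⨁_{p + q = n} X^p ⊗ Y^q`. -/
def tensorGr (n : ℤ) : Submodule ℝ (X.carrier ⊗[ℝ] Y.carrier) :=
  ⨆ p : ℤ, Submodule.map₂ (TensorProduct.mk ℝ X.carrier Y.carrier) (X.gr p) (Y.gr (n - p))

lemma tmul_mem_tensorGr {p q n : ℤ} (h : p + q = n) {v : X.carrier} {w : Y.carrier} (hv : v ∈ X.gr p)
    (hw : w ∈ Y.gr q) : v ⊗ₜ[ℝ] w ∈ tensorGr X Y n := by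
  have hq : q = n - p := by omega
  subst hq
  exact (le_iSup (fun p : ℤ => Submodule.map₂ (TensorProduct.mk ℝ X.carrier Y.carrier) (X.gr p)
    (Y.gr (n - p))) p) (Submodule.apply_mem_map₂ _ hv hw)

lemma tensorGr_induction {n : ℤ} {P : Submodule ℝ (X.carrier ⊗[ℝ] Y.carrier)}
    (h : ∀ p q : ℤ, p + q = n → ∀ v ∈ X.gr p, ∀ w ∈ Y.gr q, v ⊗ₜ[ℝ] w ∈ P) :
    tensorGr X Y n ≤ P :=
  iSup_le fun p => Submodule.map₂_le.2 fun v hv w hw => h p (n - p) (by omega) v hv w hw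

lemma tensor_hom_ext {W : Type*} [AddCommGroup W] [Module ℝ W]
    {f g : X.carrier ⊗[ℝ] Y.carrier →ₗ[ℝ] W}
    (h : ∀ p q, ∀ v ∈ X.gr p, ∀ w ∈ Y.gr q, f (v ⊗ₜ w) = g (v ⊗ₜ w)) : f = g := by
  refine TensorProduct.ext ?_
  refine hom_ext X fun p v hv => hom_ext Y fun q w hw => ?_
  exact h p q v hv w hw

/-- Auxiliary: the component `X^p ⊗ Y^q → (X ⊗ Y)^(p + q)`. -/
def tensorComponent (p q : ℤ) :
    X.gr p ⊗[ℝ] Y.gr q →ₗ[ℝ] ⨁ n, tensorGr X Y n :=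
  DirectSum.lof ℝ ℤ (fun n => tensorGr X Y n) (p + q) ∘ₗ
    LinearMap.codRestrict (tensorGr X Y (p + q))
      (TensorProduct.map (X.gr p).subtype (Y.gr q).subtype) (fun z => by
        induction z using TensorProduct.induction_on with
        | zero => simp
        | tmul v w => exact tmul_mem_tensorGr X Y rfl v.2 w.2
        | add a b ha hb => rw [map_add]; exact add_mem ha hb)

/-- Auxiliary: splitting a tensor into its homogeneous components. -/
def tensorDecompose : X.carrier ⊗[ℝ] Y.carrier →ₗ[ℝ] ⨁ n, tensorGr X Y n :=
  DirectSum.toModule ℝ (ℤ × ℤ) _ (fun pq => tensorComponent X Y pq.1 pq.2) ∘ₗ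
    (TensorProduct.directSum ℝ ℝ (fun p => X.gr p) (fun q => Y.gr q)).toLinearMap ∘ₗ
    TensorProduct.map (DirectSum.decomposeLinearEquiv X.gr).toLinearMap
      (DirectSum.decomposeLinearEquiv Y.gr).toLinearMap

lemma tensorDecompose_tmul {p q : ℤ} {v : X.carrier} {w : Y.carrier} (hv : v ∈ X.gr p)
    (hw : w ∈ Y.gr q) : tensorDecompose X Y (v ⊗ₜ w) =
      DirectSum.lof ℝ ℤ (fun n => tensorGr X Y n) (p + q)
        ⟨v ⊗ₜ w, tmul_mem_tensorGr X Y rfl hv hw⟩ := by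
  rw [tensorDecompose, LinearMap.comp_apply, LinearMap.comp_apply, TensorProduct.map_tmul]
  simp only [LinearEquiv.coe_coe, DirectSum.decomposeLinearEquiv_apply,
    DirectSum.decompose_of_mem X.gr hv, DirectSum.decompose_of_mem Y.gr hw,
    ← DirectSum.lof_eq_of ℝ]
  rw [TensorProduct.directSum_lof_tmul_lof, DirectSum.toModule_lof]
  rfl

lemma tensor_isInternal : DirectSum.IsInternal (tensorGr X Y) := by
  have hdec : ∀ n, ∀ z (hz : z ∈ tensorGr X Y n), tensorDecompose X Y z =
      DirectSum.lof ℝ ℤ (fun n => tensorGr X Y n) n ⟨z, hz⟩ := by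
    intro n z hz
    have key : tensorGr X Y n ≤ Submodule.map (tensorGr X Y n).subtype
        (LinearMap.eqLocus (tensorDecompose X Y ∘ₗ (tensorGr X Y n).subtype)
          (DirectSum.lof ℝ ℤ (fun n => tensorGr X Y n) n)) := by
      refine tensorGr_induction X Y fun p q hpq v hv w hw => ?_
      subst hpq
      exact ⟨⟨v ⊗ₜ w, tmul_mem_tensorGr X Y rfl hv hw⟩, tensorDecompose_tmul X Y hv hw, rfl⟩
    obtain ⟨⟨z', hz'⟩, h, rfl⟩ := key hz
    exact h
  let _ := DirectSum.Decomposition.ofLinearMap (tensorGr X Y) (tensorDecompose X Y)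
    (tensor_hom_ext X Y fun p q v hv w hw => by
      simp [tensorDecompose_tmul X Y hv hw])
    (DirectSum.linearMap_ext _ fun n => LinearMap.ext fun z => by
      simp [hdec n z.1 z.2])
  exact DirectSum.Decomposition.isInternal _

/-- The tensor product of complexes, `d (v ⊗ w) = d v ⊗ w + (-1)^|v| v ⊗ d w`. -/
@[reducible] def tensor : FinComplex where
  carrier := X.carrier ⊗[ℝ] Y.carrier
  gr := tensorGr X Y
  isInternal := tensor_isInternal X Y
  d := TensorProduct.map X.d LinearMap.id + TensorProduct.map (X.sgn 1) Y.d
  d_mem n := by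
    refine tensorGr_induction X Y (P := (tensorGr X Y (n + 1)).comap _) fun p q hpq v hv w hw => ?_
    simp only [Submodule.mem_comap, LinearMap.add_apply, TensorProduct.map_tmul, sgn_of_mem X 1 hv,
      LinearMap.id_apply, ← TensorProduct.smul_tmul']
    exact add_mem (tmul_mem_tensorGr X Y (by omega) (X.d_mem _ _ hv) hw)
      (Submodule.smul_mem _ _ (tmul_mem_tensorGr X Y (by omega) hv (Y.d_mem _ _ hw)))
  d_d := by
    have hX : ∀ v, X.d (X.d v) = 0 := fun v => congrArg (fun f : Module.End ℝ _ => f v) X.d_d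
    have hY : ∀ v, Y.d (Y.d v) = 0 := fun v => congrArg (fun f : Module.End ℝ _ => f v) Y.d_d
    refine tensor_hom_ext X Y fun p q v hv w hw => ?_
    simp [sgn_of_mem X 1 hv, sgn_of_mem X 1 (X.d_mem _ _ hv), hX, hY, zpow_add₀,
      TensorProduct.neg_tmul]

lemma sgn_tmul (p : ℤ) (v : X.carrier) (w : Y.carrier) :
    (X.tensor Y).sgn p (v ⊗ₜ[ℝ] w) = X.sgn p v ⊗ₜ Y.sgn p w := by
  have : (X.tensor Y).sgn p = TensorProduct.map (X.sgn p) (Y.sgn p) := by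
    refine tensor_hom_ext X Y fun m n v hv w hw => ?_
    rw [sgn_of_mem (X.tensor Y) p (tmul_mem_tensorGr X Y rfl hv hw)]
    simp [sgn_of_mem X p hv, sgn_of_mem Y p hw, mul_add, zpow_add₀,
      smul_smul, mul_comm, ← TensorProduct.smul_tmul']
  rw [this]
  rfl

lemma sgn_unit (p : ℤ) : unit.sgn p = 1 := by
  refine hom_ext unit fun n v hv => ?_
  rw [sgn_of_mem unit p hv]
  rcases eq_or_ne n 0 with rfl | hn
  · simp
  · have hv' : v = 0 := by simpa [unit, hn] using hv
    simp [hv']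

/-- Morphisms of complexes: linear maps of degree `0` that commute with the differentials. -/
@[ext]
structure Hom where
  toLin : X.carrier →ₗ[ℝ] Y.carrier
  map_mem : ∀ (n : ℤ) (v : X.carrier), v ∈ X.gr n → toLin v ∈ Y.gr n
  map_d : toLin ∘ₗ X.d = Y.d ∘ₗ toLin

instance : Category FinComplex where
  Hom := Hom
  id X := ⟨LinearMap.id, fun _ _ h => h, rfl⟩
  comp f g := ⟨g.toLin ∘ₗ f.toLin, fun n v h => g.map_mem n _ (f.map_mem n v h), by
    rw [LinearMap.comp_assoc, f.map_d, ← LinearMap.comp_assoc, g.map_d, LinearMap.comp_assoc]⟩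

@[ext]
lemma hom_ext' {X Y : FinComplex} {f g : X ⟶ Y} (h : f.toLin = g.toLin) : f = g := Hom.ext h

@[simp] lemma id_toLin : Hom.toLin (𝟙 X) = LinearMap.id := rfl

@[simp] lemma comp_toLin {X Y Z : FinComplex} (f : X ⟶ Y) (g : Y ⟶ Z) :
    (f ≫ g).toLin = g.toLin ∘ₗ f.toLin := rfl

lemma Hom.map_d_apply {X Y : FinComplex} (f : X ⟶ Y) (v : X.carrier) :
    f.toLin (X.d v) = Y.d (f.toLin v) := LinearMap.congr_fun f.map_d v

lemma Hom.map_sgn {X Y : FinComplex} (f : X ⟶ Y) (p : ℤ) (v : X.carrier) :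
    f.toLin (X.sgn p v) = Y.sgn p (f.toLin v) := by
  have : f.toLin ∘ₗ X.sgn p = Y.sgn p ∘ₗ f.toLin := by
    refine hom_ext X fun n v hv => ?_
    simp [sgn_of_mem X p hv, sgn_of_mem Y p (f.map_mem n v hv)]
  exact LinearMap.congr_fun this v

/-- An invertible morphism whose inverse is given linearly. -/
def isoMk {X Y : FinComplex} (e : X.carrier ≃ₗ[ℝ] Y.carrier)
    (h : ∀ n v, v ∈ X.gr n → e v ∈ Y.gr n) (h' : ∀ n v, v ∈ Y.gr n → e.symm v ∈ X.gr n)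
    (hd : ∀ v, e (X.d v) = Y.d (e v)) : X ≅ Y where
  hom := ⟨e.toLinearMap, h, LinearMap.ext hd⟩
  inv := ⟨e.symm.toLinearMap, h', LinearMap.ext fun v => e.injective (by simp [hd])⟩
  hom_inv_id := by ext v; simp
  inv_hom_id := by ext v; simp

def tensorHom {X Y X' Y' : FinComplex} (f : X ⟶ Y) (g : X' ⟶ Y') :
    X.tensor X' ⟶ Y.tensor Y' where
  toLin := TensorProduct.map f.toLin g.toLin
  map_mem n := tensorGr_induction X X' (P := (tensorGr Y Y' n).comap _) fun p q hpq v hv w hw =>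
    tmul_mem_tensorGr Y Y' hpq (f.map_mem p v hv) (g.map_mem q w hw)
  map_d := TensorProduct.ext' fun v w => by
    simp only [LinearMap.comp_apply, LinearMap.add_apply, TensorProduct.map_tmul, map_add,
      LinearMap.id_apply, Hom.map_d_apply, Hom.map_sgn]

def associator (X Y Z : FinComplex) : (X.tensor Y).tensor Z ≅ X.tensor (Y.tensor Z) :=
  isoMk (TensorProduct.assoc ℝ X.carrier Y.carrier Z.carrier)
    (fun n => tensorGr_induction (X.tensor Y) Z
      (P := (tensorGr X (Y.tensor Z) n).comap
        (TensorProduct.assoc ℝ X.carrier Y.carrier Z.carrier).toLinearMap)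
      fun p q hpq t ht w hw => by
        revert t
        refine tensorGr_induction X Y (P := Submodule.comap
          ((TensorProduct.mk ℝ (X.carrier ⊗[ℝ] Y.carrier) Z.carrier).flip w) (Submodule.comap
            (TensorProduct.assoc ℝ X.carrier Y.carrier Z.carrier).toLinearMap
            (tensorGr X (Y.tensor Z) n))) fun a b hab u hu v hv => ?_
        exact tmul_mem_tensorGr X (Y.tensor Z) (q := b + q) (by omega) hu
          (tmul_mem_tensorGr Y Z rfl hv hw))
    (fun n => tensorGr_induction X (Y.tensor Z)
      (P := (tensorGr (X.tensor Y) Z n).comap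
        (TensorProduct.assoc ℝ X.carrier Y.carrier Z.carrier).symm.toLinearMap)
      fun p q hpq u hu t ht => by
        revert t
        refine tensorGr_induction Y Z (P := Submodule.comap
          (TensorProduct.mk ℝ X.carrier (Y.carrier ⊗[ℝ] Z.carrier) u) (Submodule.comap
            (TensorProduct.assoc ℝ X.carrier Y.carrier Z.carrier).symm.toLinearMap
            (tensorGr (X.tensor Y) Z n))) fun a b hab v hv w hw => ?_
        exact tmul_mem_tensorGr (X.tensor Y) Z (p := p + a) (by omega)
          (tmul_mem_tensorGr X Y rfl hu hv) hw)
    (fun t => by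
      refine LinearMap.congr_fun (f := (TensorProduct.assoc ℝ X.carrier Y.carrier
        Z.carrier).toLinearMap ∘ₗ ((X.tensor Y).tensor Z).d) (g := (X.tensor (Y.tensor Z)).d ∘ₗ
        (TensorProduct.assoc ℝ X.carrier Y.carrier Z.carrier).toLinearMap) ?_ t
      refine TensorProduct.ext_threefold fun u v w => ?_
      have h := sgn_tmul X Y 1 u v
      simp only [LinearMap.comp_apply, LinearEquiv.coe_coe]
      change TensorProduct.assoc ℝ X.carrier Y.carrier Z.carrier
        ((X.d u ⊗ₜ v + X.sgn 1 u ⊗ₜ Y.d v) ⊗ₜ w + (X.tensor Y).sgn 1 (u ⊗ₜ v) ⊗ₜ Z.d w) =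
        X.d u ⊗ₜ (v ⊗ₜ w) + X.sgn 1 u ⊗ₜ (Y.d v ⊗ₜ w + Y.sgn 1 v ⊗ₜ Z.d w)
      rw [h]
      simp [TensorProduct.add_tmul, TensorProduct.tmul_add, add_assoc])

def leftUnitor (X : FinComplex) : unit.tensor X ≅ X :=
  isoMk (TensorProduct.lid ℝ X.carrier)
    (fun n => tensorGr_induction unit X (P := (X.gr n).comap
      (TensorProduct.lid ℝ X.carrier).toLinearMap) fun p q hpq (u : ℝ) hu w hw => by
        rcases eq_or_ne p 0 with rfl | hp
        · obtain rfl : q = n := by omega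
          exact (X.gr q).smul_mem u hw
        · obtain rfl : u = 0 := by simpa [unit, hp] using hu
          simp)
    (fun n v hv => tmul_mem_tensorGr unit X (p := 0) (by omega) (by simp [unit]) hv)
    (fun t => by
      refine LinearMap.congr_fun (f := (TensorProduct.lid ℝ X.carrier).toLinearMap ∘ₗ
        (unit.tensor X).d) (g := X.d ∘ₗ (TensorProduct.lid ℝ X.carrier).toLinearMap) ?_ t
      refine TensorProduct.ext' fun (u : ℝ) v => ?_
      simp [sgn_unit])

def rightUnitor (X : FinComplex) : X.tensor unit ≅ X :=
  isoMk (TensorProduct.rid ℝ X.carrier)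
    (fun n => tensorGr_induction X unit (P := (X.gr n).comap
      (TensorProduct.rid ℝ X.carrier).toLinearMap) fun p q hpq v hv (u : ℝ) hu => by
        rcases eq_or_ne q 0 with rfl | hp
        · obtain rfl : p = n := by omega
          exact (X.gr p).smul_mem u hv
        · obtain rfl : u = 0 := by simpa [unit, hp] using hu
          simp)
    (fun n v hv => tmul_mem_tensorGr X unit (q := 0) (by omega) hv (by simp [unit]))
    (fun t => by
      refine LinearMap.congr_fun (f := (TensorProduct.rid ℝ X.carrier).toLinearMap ∘ₗ
        (X.tensor unit).d) (g := X.d ∘ₗ (TensorProduct.rid ℝ X.carrier).toLinearMap) ?_ t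
      refine TensorProduct.ext' fun v (u : ℝ) => ?_
      simp)

instance : MonoidalCategoryStruct FinComplex where
  tensorObj := tensor
  tensorHom := tensorHom
  whiskerLeft X _ _ f := tensorHom (𝟙 X) f
  whiskerRight f X := tensorHom f (𝟙 X)
  tensorUnit := unit
  associator := associator
  leftUnitor := leftUnitor
  rightUnitor := rightUnitor

/-- The underlying vector space of a complex. -/
def forget : FinComplex ⥤ ModuleCat.{0} ℝ where
  obj X := ModuleCat.of ℝ X.carrier
  map f := ModuleCat.ofHom f.toLin

instance : forget.Faithful where
  map_injective h := hom_ext' (ModuleCat.hom_ext_iff.1 h)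

instance : MonoidalCategory FinComplex :=
  Monoidal.induced forget
    { μIso _ _ := .refl _
      εIso := .refl _
      whiskerLeft_eq _ _ _ _ := by ext1; exact TensorProduct.ext rfl
      whiskerRight_eq _ _ := by ext1; exact TensorProduct.ext rfl
      tensorHom_eq _ _ := by ext1; exact TensorProduct.ext rfl
      associator_eq _ _ _ := by ext1; exact TensorProduct.ext (TensorProduct.ext rfl)
      leftUnitor_eq _ := by ext1; exact TensorProduct.ext rfl
      rightUnitor_eq _ := by ext1; exact TensorProduct.ext rfl }

end FinComplex

/-! ### Differential graded Lie algebras and their representations -/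

/-- A differential graded Lie algebra over `ℝ`, with differential of degree `1`. -/
structure DGLieAlg : Type (u + 1) where
  carrier : Type u
  [addCommGroup : AddCommGroup carrier]
  [module : Module ℝ carrier]
  gr : ℤ → Submodule ℝ carrier
  isInternal : DirectSum.IsInternal gr
  bracket : carrier →ₗ[ℝ] carrier →ₗ[ℝ] carrier
  d : carrier →ₗ[ℝ] carrier
  bracket_mem : ∀ (p q : ℤ) (x y : carrier), x ∈ gr p → y ∈ gr q → bracket x y ∈ gr (p + q)
  d_mem : ∀ (p : ℤ) (x : carrier), x ∈ gr p → d x ∈ gr (p + 1)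
  d_d : ∀ x : carrier, d (d x) = 0
  bracket_skew : ∀ (p q : ℤ) (x y : carrier), x ∈ gr p → y ∈ gr q →
    bracket x y = -((-1 : ℝ) ^ (p * q) • bracket y x)
  jacobi : ∀ (p q r : ℤ) (x y z : carrier), x ∈ gr p → y ∈ gr q → z ∈ gr r →
    bracket x (bracket y z) = bracket (bracket x y) z + (-1 : ℝ) ^ (p * q) • bracket y (bracket x z)
  leibniz : ∀ (p q : ℤ) (x y : carrier), x ∈ gr p → y ∈ gr q →
    d (bracket x y) = bracket (d x) y + (-1 : ℝ) ^ p • bracket x (d y)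

attribute [instance] DGLieAlg.addCommGroup DGLieAlg.module

/-- The grading of `u𝔤 ⊕ 𝔤`: the first summand sits in degree `-1`, the second in degree `0`. -/
def cartanGr (𝔤 : Type u) [LieRing 𝔤] [LieAlgebra ℝ 𝔤] (p : ℤ) : Submodule ℝ (𝔤 × 𝔤) :=
  if p = 0 then LinearMap.ker (LinearMap.fst ℝ 𝔤 𝔤)
  else if p = -1 then LinearMap.ker (LinearMap.snd ℝ 𝔤 𝔤) else ⊥

section

variable {𝔤 : Type u} [LieRing 𝔤] [LieAlgebra ℝ 𝔤]

lemma mem_cartanGr {p : ℤ} {x : 𝔤 × 𝔤} :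
    x ∈ cartanGr 𝔤 p ↔ (p = 0 ∧ x.1 = 0) ∨ (p = -1 ∧ x.2 = 0) ∨ x = 0 := by
  rcases x with ⟨a, b⟩
  unfold cartanGr
  split_ifs with h h'
  · simp only [LinearMap.mem_ker, LinearMap.fst_apply, h, true_and, Prod.mk_eq_zero]
    grind
  · simp only [LinearMap.mem_ker, LinearMap.snd_apply, h', true_and, Prod.mk_eq_zero]
    grind
  · simp [h, h']

lemma cartanGr_isInternal : DirectSum.IsInternal (cartanGr 𝔤) := by
  rw [DirectSum.isInternal_submodule_iff_iSupIndep_and_iSup_eq_top]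
  refine ⟨fun p => ?_, eq_top_iff.2 fun x _ => ?_⟩
  · rcases eq_or_ne p 0 with rfl | hp
    · refine Disjoint.mono_right (c := LinearMap.ker (LinearMap.snd ℝ 𝔤 𝔤)) (iSup₂_le ?_) ?_
      · intro j hj x hx
        rcases mem_cartanGr.1 hx with h | h | h
        · exact absurd h.1 hj
        · exact h.2
        · simp [h]
      · rw [Submodule.disjoint_def]
        intro x hx hx'
        rcases mem_cartanGr.1 hx with h | h | h
        · exact Prod.ext h.2 hx'
        · simp at h
        · exact h
    · rcases eq_or_ne p (-1) with rfl | hp'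
      · refine Disjoint.mono_right (c := LinearMap.ker (LinearMap.fst ℝ 𝔤 𝔤)) (iSup₂_le ?_) ?_
        · intro j hj x hx
          rcases mem_cartanGr.1 hx with h | h | h
          · exact h.2
          · exact absurd h.1 hj
          · simp [h]
        · rw [Submodule.disjoint_def]
          intro x hx hx'
          rcases mem_cartanGr.1 hx with h | h | h
          · simp at h
          · exact Prod.ext hx' h.2
          · exact h
      · rw [Submodule.disjoint_def]
        intro x hx _
        rcases mem_cartanGr.1 hx with h | h | h
        · exact absurd h.1 hp
        · exact absurd h.1 hp'
        · exact h
  · have h1 : ((x.1, 0) : 𝔤 × 𝔤) ∈ ⨆ p, cartanGr 𝔤 p :=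
      le_iSup (cartanGr 𝔤) (-1) (mem_cartanGr.2 (by simp))
    have h2 : ((0, x.2) : 𝔤 × 𝔤) ∈ ⨆ p, cartanGr 𝔤 p :=
      le_iSup (cartanGr 𝔤) 0 (mem_cartanGr.2 (by simp))
    simpa using add_mem h1 h2

end

/-- The DG Lie algebra `T𝔤 = u𝔤 ⊕ 𝔤`. The pair `(a, b)` stands for `i_a + L_b`, with `i_a` in
degree `-1` and `L_b` in degree `0`; the differential is `d i_a = L_a` and the bracket is given by
the Cartan relations `[L_x, L_y] = L_[x,y]`, `[L_x, i_y] = i_[x,y]`, `[i_x, i_y] = 0`. -/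
@[reducible] def cartanAlg (𝔤 : Type u) [LieRing 𝔤] [LieAlgebra ℝ 𝔤] : DGLieAlg.{u} where
  carrier := 𝔤 × 𝔤
  gr := cartanGr 𝔤
  isInternal := cartanGr_isInternal
  bracket := LinearMap.mk₂ ℝ (fun x y => (⁅x.2, y.1⁆ + ⁅x.1, y.2⁆, ⁅x.2, y.2⁆))
    (fun x x' y => by simp [add_add_add_comm]) (fun c x y => by simp)
    (fun x y y' => by simp [add_add_add_comm]) (fun c x y => by simp)
  d := LinearMap.prod 0 (LinearMap.fst ℝ 𝔤 𝔤)
  bracket_mem p q x y hx hy := by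
    rcases x with ⟨x₁, x₂⟩
    rcases y with ⟨y₁, y₂⟩
    rw [mem_cartanGr] at hx hy ⊢
    rcases hx with ⟨rfl, h⟩ | ⟨rfl, h⟩ | h <;> rcases hy with ⟨rfl, h'⟩ | ⟨rfl, h'⟩ | h' <;>
      simp_all
  d_mem p x hx := by
    rcases x with ⟨x₁, x₂⟩
    rw [mem_cartanGr] at hx ⊢
    rcases hx with ⟨rfl, h⟩ | ⟨rfl, h⟩ | h <;> simp_all
  d_d x := by simp
  bracket_skew p q x y hx hy := by
    rcases x with ⟨x₁, x₂⟩
    rcases y with ⟨y₁, y₂⟩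
    rw [mem_cartanGr] at hx hy
    rcases hx with ⟨rfl, h⟩ | ⟨rfl, h⟩ | h <;> rcases hy with ⟨rfl, h'⟩ | ⟨rfl, h'⟩ | h' <;>
      simp_all
  jacobi p q r x y z hx hy hz := by
    rcases x with ⟨x₁, x₂⟩
    rcases y with ⟨y₁, y₂⟩
    rcases z with ⟨z₁, z₂⟩
    rw [mem_cartanGr] at hx hy hz
    rcases hx with ⟨rfl, h⟩ | ⟨rfl, h⟩ | h <;> rcases hy with ⟨rfl, h'⟩ | ⟨rfl, h'⟩ | h' <;>
      rcases hz with ⟨rfl, h''⟩ | ⟨rfl, h''⟩ | h'' <;>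
      simp_all
  leibniz p q x y hx hy := by
    rcases x with ⟨x₁, x₂⟩
    rcases y with ⟨y₁, y₂⟩
    rw [mem_cartanGr] at hx hy
    rcases hx with ⟨rfl, h⟩ | ⟨rfl, h⟩ | h <;> rcases hy with ⟨rfl, h'⟩ | ⟨rfl, h'⟩ | h' <;>
      simp_all
    rw [← lie_skew, neg_add_cancel]

/-- The element `L_x` of `T𝔤`. -/
def elemL {𝔤 : Type u} [LieRing 𝔤] [LieAlgebra ℝ 𝔤] (x : 𝔤) : (cartanAlg 𝔤).carrier := (0, x)

/-- The element `i_x` of `T𝔤`. -/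
def elemI {𝔤 : Type u} [LieRing 𝔤] [LieAlgebra ℝ 𝔤] (x : 𝔤) : (cartanAlg 𝔤).carrier := (x, 0)

/-- A representation of a DG Lie algebra `𝔥` on a complex `X`: a morphism of DG Lie algebras
`𝔥 → End X`, where `End X` carries the graded commutator and the differential `[d, -]`. -/
@[ext]
structure DGLieRep (𝔥 : DGLieAlg.{u}) (X : FinComplex) where
  act : 𝔥.carrier →ₗ[ℝ] Module.End ℝ X.carrier
  act_mem : ∀ (p n : ℤ) (x : 𝔥.carrier) (v : X.carrier), x ∈ 𝔥.gr p → v ∈ X.gr n →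
    act x v ∈ X.gr (n + p)
  act_bracket : ∀ (p q : ℤ) (x y : 𝔥.carrier), x ∈ 𝔥.gr p → y ∈ 𝔥.gr q →
    act (𝔥.bracket x y) = act x * act y - (-1 : ℝ) ^ (p * q) • (act y * act x)
  act_d : ∀ (p : ℤ) (x : 𝔥.carrier), x ∈ 𝔥.gr p →
    act (𝔥.d x) = X.d * act x - (-1 : ℝ) ^ p • (act x * X.d)

namespace DGLieRep

variable {𝔥 : DGLieAlg.{u}}

instance : DirectSum.Decomposition 𝔥.gr := 𝔥.isInternal.chooseDecomposition

lemma alg_hom_ext {W : Type*} [AddCommGroup W] [Module ℝ W] {f g : 𝔥.carrier →ₗ[ℝ] W}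
    (h : ∀ p, ∀ x ∈ 𝔥.gr p, f x = g x) : f = g := by
  ext x
  induction x using DirectSum.Decomposition.inductionOn 𝔥.gr with
  | zero => simp
  | homogeneous m => exact h _ _ m.2
  | add a b ha hb => simp [ha, hb]

variable {X Y Z : FinComplex}

lemma sgn_act (R : DGLieRep 𝔥 X) {p : ℤ} (q : ℤ) {x : 𝔥.carrier} (hx : x ∈ 𝔥.gr p)
    (v : X.carrier) : X.sgn q (R.act x v) = (-1 : ℝ) ^ (p * q) • R.act x (X.sgn q v) := by
  have : X.sgn q ∘ₗ R.act x = (-1 : ℝ) ^ (p * q) • (R.act x ∘ₗ X.sgn q) := by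
    refine FinComplex.hom_ext X fun n v hv => ?_
    simp [X.sgn_of_mem q hv, X.sgn_of_mem q (R.act_mem p n x v hx hv), smul_smul, mul_add,
      zpow_add₀, mul_comm]
  exact LinearMap.congr_fun this v

/-- The action on `X ⊗ Y`: for `x` of degree `p`,
`x (v ⊗ w) = x v ⊗ w + (-1)^(p|v|) v ⊗ x w`. -/
def tensorAct (R : DGLieRep 𝔥 X) (S : DGLieRep 𝔥 Y) :
    𝔥.carrier →ₗ[ℝ] Module.End ℝ (X.tensor Y).carrier :=
  (TensorProduct.mapBilinear (RingHom.id ℝ) X.carrier Y.carrier X.carrier Y.carrier).flip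
      LinearMap.id ∘ₗ R.act +
    (DirectSum.toModule ℝ ℤ _ fun p =>
      TensorProduct.mapBilinear (RingHom.id ℝ) X.carrier Y.carrier X.carrier Y.carrier (X.sgn p)
        ∘ₗ S.act ∘ₗ (𝔥.gr p).subtype) ∘ₗ (DirectSum.decomposeLinearEquiv 𝔥.gr).toLinearMap

lemma tensorAct_of_mem (R : DGLieRep 𝔥 X) (S : DGLieRep 𝔥 Y) {p : ℤ} {x : 𝔥.carrier}
    (hx : x ∈ 𝔥.gr p) : tensorAct R S x =
      TensorProduct.map (R.act x) LinearMap.id + TensorProduct.map (X.sgn p) (S.act x) := by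
  have h := DirectSum.decompose_of_mem 𝔥.gr hx
  rw [tensorAct, LinearMap.add_apply, LinearMap.comp_apply, LinearMap.comp_apply,
    LinearEquiv.coe_coe, DirectSum.decomposeLinearEquiv_apply, h, ← DirectSum.lof_eq_of ℝ,
    DirectSum.toModule_lof]
  rfl

lemma neg_one_zpow_mul_self (n : ℤ) : (-1 : ℝ) ^ n * (-1 : ℝ) ^ n = 1 := by
  rw [← mul_zpow]
  simp

lemma d_tmul (v : X.carrier) (w : Y.carrier) :
    (X.tensor Y).d (v ⊗ₜ[ℝ] w) = X.d v ⊗ₜ w + X.sgn 1 v ⊗ₜ Y.d w := rfl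

def tensor (R : DGLieRep 𝔥 X) (S : DGLieRep 𝔥 Y) : DGLieRep 𝔥 (X.tensor Y) where
  act := tensorAct R S
  act_mem p n x t hx := by
    revert t
    rw [tensorAct_of_mem R S hx]
    refine FinComplex.tensorGr_induction X Y
      (P := (FinComplex.tensorGr X Y (n + p)).comap _) fun a b hab v hv w hw => ?_
    simp only [Submodule.mem_comap, LinearMap.add_apply, TensorProduct.map_tmul,
      X.sgn_of_mem p hv, LinearMap.id_apply, ← TensorProduct.smul_tmul']
    exact add_mem (FinComplex.tmul_mem_tensorGr X Y (by omega) (R.act_mem _ _ _ _ hx hv) hw)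
      (Submodule.smul_mem _ _ (FinComplex.tmul_mem_tensorGr X Y (by omega) hv
        (S.act_mem _ _ _ _ hx hw)))
  act_bracket p q x y hx hy := by
    rw [tensorAct_of_mem R S (𝔥.bracket_mem p q x y hx hy), tensorAct_of_mem R S hx,
      tensorAct_of_mem R S hy, R.act_bracket p q x y hx hy, S.act_bracket p q x y hx hy]
    refine FinComplex.tensor_hom_ext X Y fun m n v hv w hw => ?_
    simp only [LinearMap.add_apply, LinearMap.sub_apply, LinearMap.smul_apply,
      Module.End.mul_apply, TensorProduct.map_tmul, map_add, LinearMap.id_apply,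
      X.sgn_of_mem _ hv, X.sgn_of_mem _ (R.act_mem _ _ _ _ hx hv),
      X.sgn_of_mem _ (R.act_mem _ _ _ _ hy hv), map_smul, TensorProduct.sub_tmul,
      TensorProduct.tmul_sub, ← TensorProduct.smul_tmul', TensorProduct.tmul_smul]
    have e := neg_one_zpow_mul_self (p * q)
    have h : (-1 : ℝ) ≠ 0 := by norm_num
    simp only [add_mul, mul_add, zpow_add₀ h, mul_comm q p]
    generalize (-1 : ℝ) ^ (p * q) = a at *
    generalize (-1 : ℝ) ^ (p * m) = b
    generalize (-1 : ℝ) ^ (q * m) = c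
    match_scalars <;> grind
  act_d p x hx := by
    rw [tensorAct_of_mem R S (𝔥.d_mem p x hx), tensorAct_of_mem R S hx, R.act_d p x hx,
      S.act_d p x hx]
    refine FinComplex.tensor_hom_ext X Y fun m n v hv w hw => ?_
    simp only [LinearMap.add_apply, LinearMap.sub_apply, LinearMap.smul_apply,
      Module.End.mul_apply, TensorProduct.map_tmul, map_add, LinearMap.id_apply,
      X.sgn_of_mem _ hv, X.sgn_of_mem _ (R.act_mem _ _ _ _ hx hv),
      X.sgn_of_mem _ (X.d_mem _ _ hv), map_smul, TensorProduct.sub_tmul,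
      TensorProduct.tmul_sub, ← TensorProduct.smul_tmul', TensorProduct.tmul_smul]
    have e := neg_one_zpow_mul_self p
    have h : (-1 : ℝ) ≠ 0 := by norm_num
    simp only [add_mul, mul_add, zpow_add₀ h, one_mul, mul_one]
    generalize (-1 : ℝ) ^ p = a at *
    generalize (-1 : ℝ) ^ (p * m) = b
    generalize (-1 : ℝ) ^ m = c
    match_scalars <;> grind

/-- The trivial representation on `ℝ`. -/
def trivial : DGLieRep 𝔥 FinComplex.unit where
  act := 0
  act_mem := by simp
  act_bracket := by simp
  act_d := by simp

end DGLieRep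

/-- A complex with a representation of `𝔥`. -/
structure Rep (𝔥 : DGLieAlg.{u}) : Type (max 1 u) where
  cpx : FinComplex
  rep : DGLieRep 𝔥 cpx

namespace Rep

variable {𝔥 : DGLieAlg.{u}}

/-- Morphisms of representations: equivariant morphisms of complexes. -/
@[ext]
structure Hom (V W : Rep 𝔥) where
  hom : V.cpx ⟶ W.cpx
  equivariant : ∀ x : 𝔥.carrier, hom.toLin ∘ₗ V.rep.act x = W.rep.act x ∘ₗ hom.toLin

instance : Category (Rep 𝔥) where
  Hom := Hom
  id V := ⟨𝟙 _, fun _ => rfl⟩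
  comp f g := ⟨f.hom ≫ g.hom, fun x => by
    rw [FinComplex.comp_toLin, LinearMap.comp_assoc, f.equivariant, ← LinearMap.comp_assoc,
      g.equivariant, LinearMap.comp_assoc]⟩

@[ext]
lemma hom_ext {V W : Rep 𝔥} {f g : V ⟶ W} (h : f.hom = g.hom) : f = g := Hom.ext h

@[simp] lemma id_hom (V : Rep 𝔥) : Hom.hom (𝟙 V) = 𝟙 V.cpx := rfl

@[simp] lemma comp_hom {U V W : Rep 𝔥} (f : U ⟶ V) (g : V ⟶ W) :
    (f ≫ g).hom = f.hom ≫ g.hom := rfl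

lemma Hom.equivariant_apply {V W : Rep 𝔥} (f : V ⟶ W) (x : 𝔥.carrier) (v : V.cpx.carrier) :
    f.hom.toLin (V.rep.act x v) = W.rep.act x (f.hom.toLin v) :=
  LinearMap.congr_fun (f.equivariant x) v

/-- The underlying complex of a representation. -/
def forget (𝔥 : DGLieAlg.{u}) : Rep 𝔥 ⥤ FinComplex where
  obj V := V.cpx
  map f := f.hom

instance : (forget 𝔥).Faithful where
  map_injective h := hom_ext h

lemma equivariant_inv {X Y : FinComplex} (e : X ≅ Y) {a : Module.End ℝ X.carrier}
    {b : Module.End ℝ Y.carrier} (h : e.hom.toLin ∘ₗ a = b ∘ₗ e.hom.toLin) :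
    e.inv.toLin ∘ₗ b = a ∘ₗ e.inv.toLin := by
  have h1 : e.inv.toLin ∘ₗ e.hom.toLin = LinearMap.id := by
    rw [← FinComplex.comp_toLin, e.hom_inv_id, FinComplex.id_toLin]
  have h2 : e.hom.toLin ∘ₗ e.inv.toLin = LinearMap.id := by
    rw [← FinComplex.comp_toLin, e.inv_hom_id, FinComplex.id_toLin]
  calc e.inv.toLin ∘ₗ b = e.inv.toLin ∘ₗ (b ∘ₗ e.hom.toLin) ∘ₗ e.inv.toLin := by
        rw [LinearMap.comp_assoc, h2, LinearMap.comp_id]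
    _ = a ∘ₗ e.inv.toLin := by
        rw [← h, ← LinearMap.comp_assoc, ← LinearMap.comp_assoc, h1, LinearMap.id_comp]

def isoMk {V W : Rep 𝔥} (e : V.cpx ≅ W.cpx)
    (h : ∀ x, e.hom.toLin ∘ₗ V.rep.act x = W.rep.act x ∘ₗ e.hom.toLin) : V ≅ W where
  hom := ⟨e.hom, h⟩
  inv := ⟨e.inv, fun x => equivariant_inv e (h x)⟩

lemma equivariant_of_homogeneous {X Y : FinComplex} {f : X.carrier →ₗ[ℝ] Y.carrier}
    {R : DGLieRep 𝔥 X} {S : DGLieRep 𝔥 Y}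
    (h : ∀ p, ∀ x ∈ 𝔥.gr p, f ∘ₗ R.act x = S.act x ∘ₗ f) (x : 𝔥.carrier) :
    f ∘ₗ R.act x = S.act x ∘ₗ f := by
  induction x using DirectSum.Decomposition.inductionOn 𝔥.gr with
  | zero => simp
  | homogeneous m => exact h _ _ m.2
  | add a b ha hb => rw [map_add, map_add, LinearMap.comp_add, LinearMap.add_comp, ha, hb]

@[reducible] def tensor (V W : Rep 𝔥) : Rep 𝔥 := ⟨V.cpx.tensor W.cpx, V.rep.tensor W.rep⟩

def tensorHom {V W V' W' : Rep 𝔥} (f : V ⟶ W) (g : V' ⟶ W') : V.tensor V' ⟶ W.tensor W' where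
  hom := FinComplex.tensorHom f.hom g.hom
  equivariant := equivariant_of_homogeneous fun p x hx => by
    refine TensorProduct.ext' fun v w => ?_
    simp only [DGLieRep.tensor, DGLieRep.tensorAct_of_mem _ _ hx, FinComplex.tensorHom,
      LinearMap.comp_apply, LinearMap.add_apply, TensorProduct.map_tmul, map_add,
      LinearMap.id_apply, Hom.equivariant_apply, FinComplex.Hom.map_sgn]

def associator (U V W : Rep 𝔥) : (U.tensor V).tensor W ≅ U.tensor (V.tensor W) :=
  isoMk (FinComplex.associator U.cpx V.cpx W.cpx) <| equivariant_of_homogeneous fun p x hx => by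
    refine TensorProduct.ext_threefold fun u v w => ?_
    have e := FinComplex.sgn_tmul U.cpx V.cpx p u v
    simp only [DGLieRep.tensor, DGLieRep.tensorAct_of_mem _ _ hx]
    change TensorProduct.assoc ℝ U.cpx.carrier V.cpx.carrier W.cpx.carrier
      ((U.rep.act x u ⊗ₜ v + U.cpx.sgn p u ⊗ₜ V.rep.act x v) ⊗ₜ w +
        (U.cpx.tensor V.cpx).sgn p (u ⊗ₜ v) ⊗ₜ W.rep.act x w) =
      U.rep.act x u ⊗ₜ (v ⊗ₜ w) +
        U.cpx.sgn p u ⊗ₜ (V.rep.act x v ⊗ₜ w + V.cpx.sgn p v ⊗ₜ W.rep.act x w)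
    rw [e]
    simp [TensorProduct.add_tmul, TensorProduct.tmul_add, add_assoc]

def leftUnitor (V : Rep 𝔥) : Rep.tensor ⟨FinComplex.unit, DGLieRep.trivial⟩ V ≅ V :=
  isoMk (FinComplex.leftUnitor V.cpx) <| equivariant_of_homogeneous fun p x hx => by
    refine TensorProduct.ext' fun (u : ℝ) v => ?_
    simp only [DGLieRep.tensor, DGLieRep.tensorAct_of_mem _ _ hx, FinComplex.sgn_unit]
    change TensorProduct.lid ℝ V.cpx.carrier ((0 : ℝ) ⊗ₜ v + u ⊗ₜ V.rep.act x v) =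
      V.rep.act x (TensorProduct.lid ℝ V.cpx.carrier (u ⊗ₜ v))
    simp

def rightUnitor (V : Rep 𝔥) : Rep.tensor V ⟨FinComplex.unit, DGLieRep.trivial⟩ ≅ V :=
  isoMk (FinComplex.rightUnitor V.cpx) <| equivariant_of_homogeneous fun p x hx => by
    refine TensorProduct.ext' fun v (u : ℝ) => ?_
    simp only [DGLieRep.tensor, DGLieRep.tensorAct_of_mem _ _ hx]
    change TensorProduct.rid ℝ V.cpx.carrier (V.rep.act x v ⊗ₜ u + V.cpx.sgn p v ⊗ₜ (0 : ℝ)) =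
      V.rep.act x (TensorProduct.rid ℝ V.cpx.carrier (v ⊗ₜ u))
    simp

instance : MonoidalCategoryStruct (Rep 𝔥) where
  tensorObj := tensor
  tensorHom := tensorHom
  whiskerLeft V _ _ f := tensorHom (𝟙 V) f
  whiskerRight f V := tensorHom f (𝟙 V)
  tensorUnit := ⟨FinComplex.unit, DGLieRep.trivial⟩
  associator := associator
  leftUnitor := leftUnitor
  rightUnitor := rightUnitor

instance : MonoidalCategory (Rep 𝔥) :=
  Monoidal.induced (forget 𝔥)
    { μIso _ _ := .refl _
      εIso := .refl _
      whiskerLeft_eq _ _ _ _ := by ext1; exact TensorProduct.ext rfl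
      whiskerRight_eq _ _ := by ext1; exact TensorProduct.ext rfl
      tensorHom_eq _ _ := by ext1; exact TensorProduct.ext rfl
      associator_eq _ _ _ := by ext1; exact TensorProduct.ext (TensorProduct.ext rfl)
      leftUnitor_eq _ := by ext1; exact TensorProduct.ext rfl
      rightUnitor_eq _ := by ext1; exact TensorProduct.ext rfl }

end Rep

/-! ### Smooth simplices and smooth cubes -/

/-- The standard simplex `Δ_k = {1 ≥ t_1 ≥ ⋯ ≥ t_k ≥ 0}` in `ℝ^k`. -/
def stdSimp (k : ℕ) : Set (Fin k → ℝ) := {t | Antitone t ∧ ∀ i, t i ∈ Icc (0 : ℝ) 1}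

/-- The cube `I^k = [0,1]^k`. -/
def stdCube (k : ℕ) : Set (Fin k → ℝ) := {t | ∀ i, t i ∈ Icc (0 : ℝ) 1}

/-- The vertex `v_i = (1, …, 1, 0, …, 0)` of `Δ_k`, with `i` ones. -/
def vertex (k : ℕ) (i : Fin (k + 1)) : Fin k → ℝ := fun j => if j.val < i.val then 1 else 0

/-- For `t ∈ ℝ^k`: the sequence `1, t_1, …, t_k, 0, 0, …`. -/
def padded {k : ℕ} (t : Fin k → ℝ) : ℕ → ℝ
  | 0 => 1
  | j + 1 => if h : j < k then t ⟨j, h⟩ else 0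

/-- The barycentric coordinates `t_i - t_{i+1}` with respect to the vertices of `Δ_k`. -/
def bary {k : ℕ} (t : Fin k → ℝ) (i : Fin (k + 1)) : ℝ := padded t i - padded t (i + 1)

/-- The affine map `ℝ^k → F` that sends the vertex `v_i` of `Δ_k` to `w i`. -/
def affineMap {k : ℕ} {F : Type*} [AddCommGroup F] [Module ℝ F] (w : Fin (k + 1) → F)
    (t : Fin k → ℝ) : F := ∑ i, bary t i • w i

/-- The affine map `ℝ^m → ℝ^k` that sends the vertex `v_i` of `Δ_m` to the vertex `v_(α i)` of
`Δ_k`. -/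
def vertexMap {m k : ℕ} (α : Fin (m + 1) → Fin (k + 1)) : (Fin m → ℝ) → Fin k → ℝ :=
  affineMap fun i => vertex k (α i)

lemma bary_nonneg {k : ℕ} {t : Fin k → ℝ} (ht : t ∈ stdSimp k) (i : Fin (k + 1)) :
    0 ≤ bary t i := by
  rw [bary, sub_nonneg]
  rcases i with ⟨_ | j, hj⟩
  · simp only [padded]
    split_ifs with h
    · exact (ht.2 _).2
    · exact zero_le_one
  · simp only [padded]
    split_ifs with h h' h'
    · exact ht.1 (Fin.mk_le_mk.2 (Nat.le_succ j))
    · omega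
    · exact (ht.2 _).1
    · exact le_rfl

lemma sum_bary {k : ℕ} (t : Fin k → ℝ) : ∑ i, bary t i = 1 := by
  have h := Finset.sum_range_sub' (padded t) (k + 1)
  rw [Finset.sum_range] at h
  exact h.trans (by simp [padded])

lemma padded_affineMap {m k : ℕ} (w : Fin (k + 1) → Fin m → ℝ) (t : Fin k → ℝ) (n : ℕ) :
    padded (affineMap w t) n = ∑ i, bary t i * padded (w i) n := by
  cases n with
  | zero => simp [padded, sum_bary]
  | succ n =>
    simp only [padded]
    split_ifs with h
    · simp [affineMap, Finset.sum_apply]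
    · simp

lemma bary_affineMap {m k : ℕ} (w : Fin (k + 1) → Fin m → ℝ) (t : Fin k → ℝ) (j : Fin (m + 1)) :
    bary (affineMap w t) j = ∑ i, bary t i * bary (w i) j := by
  simp only [bary, padded_affineMap, ← Finset.sum_sub_distrib, mul_sub]

lemma bary_vertex {k : ℕ} (i j : Fin (k + 1)) : bary (vertex k i) j = if i = j then 1 else 0 := by
  rcases i with ⟨i, hi⟩
  rcases j with ⟨_ | j, hj⟩
  · simp only [bary, padded, vertex, Fin.mk.injEq]
    split_ifs <;> first | omega | simp
  · simp only [bary, padded, vertex, Fin.mk.injEq]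
    split_ifs <;> first | omega | simp

lemma bary_injective {k : ℕ} {t t' : Fin k → ℝ} (h : ∀ i, bary t i = bary t' i) : t = t' := by
  have key : ∀ n ≤ k, padded t n = padded t' n := by
    intro n
    induction n with
    | zero => simp [padded]
    | succ n ih =>
      intro hn
      have h1 := h ⟨n, by omega⟩
      have h2 := ih (by omega)
      simp only [bary] at h1
      linarith
  ext j
  have := key (j.val + 1) j.2
  simpa [padded] using this

lemma affineMap_vertex {k : ℕ} (t : Fin k → ℝ) : affineMap (vertex k) t = t :=
  bary_injective fun j => by simp [bary_affineMap, bary_vertex]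

lemma vertex_mem {k : ℕ} (i : Fin (k + 1)) : vertex k i ∈ stdSimp k := by
  refine ⟨fun a b hab => ?_, fun j => ?_⟩
  · have : a.val ≤ b.val := hab
    simp only [vertex]
    split_ifs <;> first | omega | simp
  · simp only [vertex]
    split_ifs <;> simp

lemma convex_stdSimp (k : ℕ) : Convex ℝ (stdSimp k) := by
  intro x hx y hy a b ha hb hab
  refine ⟨fun i j hij => ?_, fun i => convex_Icc (0 : ℝ) 1 (hx.2 i) (hy.2 i) ha hb hab⟩
  have h1 := mul_le_mul_of_nonneg_left (hx.1 hij) ha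
  have h2 := mul_le_mul_of_nonneg_left (hy.1 hij) hb
  simpa using add_le_add h1 h2

lemma convex_stdCube (k : ℕ) : Convex ℝ (stdCube k) := fun _ hx _ hy _ _ ha hb hab i =>
  convex_Icc (0 : ℝ) 1 (hx i) (hy i) ha hb hab

lemma stdSimp_subset_stdCube (k : ℕ) : stdSimp k ⊆ stdCube k := fun _ h => h.2

lemma affineMap_mem {k : ℕ} {F : Type*} [AddCommGroup F] [Module ℝ F] {S : Set F}
    (hS : Convex ℝ S) {w : Fin (k + 1) → F} (hw : ∀ i, w i ∈ S) {t : Fin k → ℝ}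
    (ht : t ∈ stdSimp k) : affineMap w t ∈ S :=
  hS.sum_mem (fun i _ => bary_nonneg ht i) (sum_bary t) fun i _ => hw i

lemma vertexMap_mem {m k : ℕ} (α : Fin (m + 1) → Fin (k + 1)) :
    MapsTo (vertexMap α) (stdSimp m) (stdSimp k) := fun _ ht =>
  affineMap_mem (convex_stdSimp k) (fun _ => vertex_mem _) ht

lemma contDiff_affineMap {k : ℕ} {F : Type*} [NormedAddCommGroup F] [NormedSpace ℝ F]
    (w : Fin (k + 1) → F) : ContDiff ℝ ∞ (affineMap w) := by
  have h : ∀ n, ContDiff ℝ ∞ fun t : Fin k → ℝ => padded t n := by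
    intro n
    cases n with
    | zero => exact contDiff_const
    | succ n =>
      simp only [padded]
      split_ifs
      · exact contDiff_apply ℝ ℝ _
      · exact contDiff_const
  exact ContDiff.sum fun i _ => ((h _).sub (h _)).smul contDiff_const

lemma vertexMap_comp {l m k : ℕ} (β : Fin (m + 1) → Fin (k + 1)) (α : Fin (l + 1) → Fin (m + 1))
    (t : Fin l → ℝ) : vertexMap β (vertexMap α t) = vertexMap (β ∘ α) t :=
  bary_injective fun j => by
    simp only [vertexMap, bary_affineMap, bary_vertex, Finset.sum_mul, Function.comp_apply]
    rw [Finset.sum_comm]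
    refine Finset.sum_congr rfl fun x _ => ?_
    rw [Finset.sum_eq_single (α x) (fun b _ hb => by simp [hb.symm]) (by simp)]
    simp

section

variable {E : Type*} [NormedAddCommGroup E] [NormedSpace ℝ E]
  {H : Type*} [TopologicalSpace H] (I : ModelWithCorners ℝ E H)
  (G : Type*) [TopologicalSpace G] [ChartedSpace H G] [Group G]

/-- A smooth map from a subset `S` of `ℝ^k` to `G`. -/
@[ext]
structure SmoothMapOn {k : ℕ} (S : Set (Fin k → ℝ)) where
  toFun : S → G
  smooth : ContMDiffOn 𝓘(ℝ, Fin k → ℝ) I ∞ (Function.extend Subtype.val toFun fun _ => 1) S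

/-- Smooth singular simplices `Δ_k → G`. -/
abbrev Simplex (k : ℕ) := SmoothMapOn I G (stdSimp k)

/-- Smooth singular cubes `I^k → G`. -/
abbrev Cube (k : ℕ) := SmoothMapOn I G (stdCube k)

variable {I G}

namespace SmoothMapOn

variable {k m : ℕ} {S : Set (Fin k → ℝ)} {S' : Set (Fin m → ℝ)}

/-- The extension by `1` to `ℝ^k`; only the values on `S` matter. -/
def ext' (σ : SmoothMapOn I G S) : (Fin k → ℝ) → G :=
  Function.extend Subtype.val σ.toFun fun _ => 1

lemma ext'_apply (σ : SmoothMapOn I G S) (t : S) : σ.ext' t = σ.toFun t :=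
  Subtype.val_injective.extend_apply _ _ t

/-- A function on `ℝ^k` which is smooth on `S` defines a smooth map on `S`. -/
def ofFun (f : (Fin k → ℝ) → G) (hf : ContMDiffOn 𝓘(ℝ, Fin k → ℝ) I ∞ f S) :
    SmoothMapOn I G S where
  toFun t := f t
  smooth := hf.congr fun t ht => Subtype.val_injective.extend_apply (fun t : S => f t) _ ⟨t, ht⟩

/-- The composite `σ ∘ g`. -/
def pull (σ : SmoothMapOn I G S) (g : (Fin m → ℝ) → Fin k → ℝ) (hg : ContDiff ℝ ∞ g)
    (h : MapsTo g S' S) : SmoothMapOn I G S' :=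
  ofFun (σ.ext' ∘ g) (σ.smooth.comp hg.contMDiff.contMDiffOn h)

/-- The pointwise product in `G`. -/
def mul [LieGroup I ∞ G] (σ τ : SmoothMapOn I G S) : SmoothMapOn I G S :=
  ofFun (fun t => σ.ext' t * τ.ext' t) (σ.smooth.mul τ.smooth)

end SmoothMapOn

variable (I) in
/-- The `0`-simplex at a point of `G`. -/
def pointSimplex (g : G) : Simplex I G 0 := SmoothMapOn.ofFun (fun _ => g) contMDiffOn_const

/-- The face of `σ` spanned by the vertices `v_(α 0), …, v_(α m)`. -/
def subface {k : ℕ} (σ : Simplex I G k) {m : ℕ} (α : Fin (m + 1) → Fin (k + 1)) : Simplex I G m :=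
  σ.pull (vertexMap α) (contDiff_affineMap _) (vertexMap_mem α)

lemma subface_subface {k m l : ℕ} (σ : Simplex I G k) (β : Fin (m + 1) → Fin (k + 1))
    (α : Fin (l + 1) → Fin (m + 1)) : subface (subface σ β) α = subface σ (β ∘ α) := by
  ext t
  change (subface σ β).ext' (vertexMap α t) = σ.ext' (vertexMap (β ∘ α) t)
  rw [← vertexMap_comp]
  exact SmoothMapOn.ext'_apply _ ⟨_, vertexMap_mem α t.2⟩

lemma subface_id {k : ℕ} (σ : Simplex I G k) : subface σ id = σ := by
  ext t
  change σ.ext' (affineMap (vertex k) t) = σ.toFun t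
  rw [affineMap_vertex, SmoothMapOn.ext'_apply]

/-! ### The chains on `G` -/

variable (I G) in
/-- The space `C_•(G)` of smooth singular chains with real coefficients. -/
abbrev Chain := (Σ k : ℕ, Simplex I G k) →₀ ℝ

/-- A simplex regarded as a chain. -/
def chain {k : ℕ} (σ : Simplex I G k) : Chain I G := Finsupp.single ⟨k, σ⟩ 1

variable (I G) in
/-- The linear map out of `C_•(G)` with prescribed values on simplices. -/
def Chain.lift {W : Type*} [AddCommGroup W] [Module ℝ W] (f : ∀ k, Simplex I G k → W) :
    Chain I G →ₗ[ℝ] W :=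
  Finsupp.linearCombination ℝ fun s : Σ k : ℕ, Simplex I G k => f s.1 s.2

/-- The boundary of a simplex, `∑ (-1)^i σ|[v_0, …, v̂_i, …, v_k]`. -/
def simplexBoundary : ∀ k, Simplex I G k → Chain I G
  | 0, _ => 0
  | k + 1, σ => ∑ i : Fin (k + 2), (-1 : ℝ) ^ i.val • chain (subface σ i.succAbove)

variable (I G) in
/-- The boundary operator on chains. -/
def boundary : Chain I G →ₗ[ℝ] Chain I G := Chain.lift I G simplexBoundary

/-- The `(r, s)`-shuffles. -/
abbrev Shuffle (r s : ℕ) : Type :=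
  {χ : Equiv.Perm (Fin (r + s)) //
    StrictMono (fun i => χ (Fin.castAdd s i)) ∧ StrictMono (fun i => χ (Fin.natAdd r i))}

/-- The map `t ↦ (t_(α 1), …, t_(α m))`. -/
def coordMap {m k : ℕ} (α : Fin m → Fin k) (t : Fin k → ℝ) : Fin m → ℝ := fun i => t (α i)

lemma contDiff_coordMap {m k : ℕ} (α : Fin m → Fin k) : ContDiff ℝ ∞ (coordMap α) :=
  contDiff_pi.2 fun _ => contDiff_apply ℝ ℝ _

lemma coordMap_mem {m k : ℕ} {α : Fin m → Fin k} (hα : StrictMono α) :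
    MapsTo (coordMap α) (stdSimp k) (stdSimp m) := fun _ ht =>
  ⟨ht.1.comp_monotone hα.monotone, fun i => ht.2 (α i)⟩

lemma coordMap_mem_cube {m k : ℕ} (α : Fin m → Fin k) :
    MapsTo (coordMap α) (stdCube k) (stdCube m) := fun _ ht i => ht (α i)

/-- The front face of `σ` on the vertices `v_0, …, v_i`. -/
def front {k : ℕ} (σ : Simplex I G k) (i : Fin (k + 1)) : Simplex I G i :=
  subface σ fun j => ⟨j.val, by omega⟩

/-- The back face of `σ` on the vertices `v_i, …, v_k`. -/
def back {k : ℕ} (σ : Simplex I G k) (i : Fin (k + 1)) : Simplex I G (k - i) :=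
  subface σ fun j => ⟨j.val + i.val, by omega⟩

variable (I G) in
/-- The coproduct of `C_•(G)`: the diagonal followed by the Alexander-Whitney map. -/
def comul : Chain I G →ₗ[ℝ] Chain I G ⊗[ℝ] Chain I G :=
  Chain.lift I G fun _ σ => ∑ i, chain (front σ i) ⊗ₜ[ℝ] chain (back σ i)

variable (I G) in
/-- The counit of `C_•(G)`: it is `1` on `0`-simplices and `0` on all others. -/
def counit : Chain I G →ₗ[ℝ] ℝ := Chain.lift I G fun k _ => if k = 0 then 1 else 0

lemma chain_lift {W : Type*} [AddCommGroup W] [Module ℝ W] (f : ∀ k, Simplex I G k → W) {k : ℕ}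
    (σ : Simplex I G k) : Chain.lift I G f (chain σ) = f k σ := by
  simp [Chain.lift, chain]

lemma chain_hom_ext {W : Type*} [AddCommGroup W] [Module ℝ W] {f g : Chain I G →ₗ[ℝ] W}
    (h : ∀ k (σ : Simplex I G k), f (chain σ) = g (chain σ)) : f = g :=
  Finsupp.lhom_ext' fun s => LinearMap.ext_ring (h s.1 s.2)

lemma chain_subface_congr {k m m' : ℕ} (σ : Simplex I G k) (h : m = m')
    {α : Fin (m + 1) → Fin (k + 1)} {β : Fin (m' + 1) → Fin (k + 1)}
    (hαβ : ∀ j : ℕ, ∀ h₁ h₂, (α ⟨j, h₁⟩).val = (β ⟨j, h₂⟩).val) :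
    chain (subface σ α) = chain (subface σ β) := by
  subst h
  obtain rfl : α = β := funext fun j => Fin.ext (hαβ j.val j.2 j.2)
  rfl

/-! ### Complexes with an action of the chains -/

variable (I G) in
/-- A complex with a linear action of `C_•(G)`. The axioms of a DG module are imposed separately
by `IsDGModule`. -/
structure ChainAction where
  cpx : FinComplex
  act : Chain I G →ₗ[ℝ] Module.End ℝ cpx.carrier

namespace ChainAction

/-- Morphisms: morphisms of complexes that commute with the action of the chains. -/
@[ext]
structure Hom (V W : ChainAction I G) where
  hom : V.cpx ⟶ W.cpx
  equivariant : ∀ c : Chain I G, hom.toLin ∘ₗ V.act c = W.act c ∘ₗ hom.toLin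

instance : Category (ChainAction I G) where
  Hom := Hom
  id V := ⟨𝟙 _, fun _ => rfl⟩
  comp f g := ⟨f.hom ≫ g.hom, fun x => by
    rw [FinComplex.comp_toLin, LinearMap.comp_assoc, f.equivariant, ← LinearMap.comp_assoc,
      g.equivariant, LinearMap.comp_assoc]⟩

@[ext]
lemma hom_ext {V W : ChainAction I G} {f g : V ⟶ W} (h : f.hom = g.hom) : f = g := Hom.ext h

@[simp] lemma id_hom (V : ChainAction I G) : Hom.hom (𝟙 V) = 𝟙 V.cpx := rfl

@[simp] lemma comp_hom {U V W : ChainAction I G} (f : U ⟶ V) (g : V ⟶ W) :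
    (f ≫ g).hom = f.hom ≫ g.hom := rfl

lemma Hom.equivariant_apply {V W : ChainAction I G} (f : V ⟶ W) (c : Chain I G)
    (v : V.cpx.carrier) : f.hom.toLin (V.act c v) = W.act c (f.hom.toLin v) :=
  LinearMap.congr_fun (f.equivariant c) v

variable (I G) in
/-- The underlying complex. -/
def forget : ChainAction I G ⥤ FinComplex where
  obj V := V.cpx
  map f := f.hom

instance : (forget I G).Faithful where
  map_injective h := hom_ext h

lemma equivariant_of_chain {V W : ChainAction I G} {f : V.cpx.carrier →ₗ[ℝ] W.cpx.carrier}
    (h : ∀ k (σ : Simplex I G k), f ∘ₗ V.act (chain σ) = W.act (chain σ) ∘ₗ f) (c : Chain I G) :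
    f ∘ₗ V.act c = W.act c ∘ₗ f := by
  refine LinearMap.congr_fun (f := LinearMap.compRight ℝ f ∘ₗ V.act)
    (g := LinearMap.lcomp ℝ _ f ∘ₗ W.act) (chain_hom_ext h) c

def isoMk {V W : ChainAction I G} (e : V.cpx ≅ W.cpx)
    (h : ∀ c, e.hom.toLin ∘ₗ V.act c = W.act c ∘ₗ e.hom.toLin) : V ≅ W where
  hom := ⟨e.hom, h⟩
  inv := ⟨e.inv, fun c => Rep.equivariant_inv e (h c)⟩

/-- The map `C_•(G) ⊗ C_•(G) → End (X ⊗ Y)` induced by two actions: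
`(a ⊗ b) (v ⊗ w) = (-1)^(|b||v|) a v ⊗ b w`. -/
def koszulPairing (V W : ChainAction I G) :
    Chain I G ⊗[ℝ] Chain I G →ₗ[ℝ] Module.End ℝ (V.cpx.tensor W.cpx).carrier :=
  TensorProduct.lift <| LinearMap.flip <| Chain.lift I G fun k ν =>
    (TensorProduct.mapBilinear (RingHom.id ℝ) V.cpx.carrier W.cpx.carrier V.cpx.carrier
      W.cpx.carrier).flip (W.act (chain ν)) ∘ₗ
      LinearMap.lcomp ℝ V.cpx.carrier (V.cpx.sgn (-(k : ℤ))) ∘ₗ V.act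

/-- The tensor product, with the action obtained from the coproduct of `C_•(G)`. -/
@[reducible] def tensor (V W : ChainAction I G) : ChainAction I G where
  cpx := V.cpx.tensor W.cpx
  act := koszulPairing V W ∘ₗ comul I G

lemma tensor_act_chain (V W : ChainAction I G) {k : ℕ} (σ : Simplex I G k) :
    (V.tensor W).act (chain σ) = ∑ i, TensorProduct.map
      (V.act (chain (front σ i)) ∘ₗ V.cpx.sgn (-((k - i.val : ℕ) : ℤ)))
      (W.act (chain (back σ i))) := by
  rw [LinearMap.comp_apply, comul, chain_lift, map_sum]
  refine Finset.sum_congr rfl fun i _ => ?_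
  rw [koszulPairing, TensorProduct.lift.tmul, LinearMap.flip_apply, chain_lift]
  rfl

lemma tensor_act_apply (V W : ChainAction I G) {k : ℕ} (σ : Simplex I G k) (v : V.cpx.carrier)
    (w : W.cpx.carrier) : (V.tensor W).act (chain σ) (v ⊗ₜ[ℝ] w) =
      ∑ i, V.act (chain (front σ i)) (V.cpx.sgn (-((k - i.val : ℕ) : ℤ)) v) ⊗ₜ[ℝ]
        W.act (chain (back σ i)) w := by
  rw [tensor_act_chain]
  simp only [LinearMap.sum_apply, TensorProduct.map_tmul, LinearMap.comp_apply]

lemma unit_act_apply {k : ℕ} (σ : Simplex I G k) (u : ℝ) :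
    ((counit I G).smulRight (1 : Module.End ℝ ℝ)) (chain σ) u = if k = 0 then u else 0 := by
  rw [LinearMap.smulRight_apply, counit, chain_lift]
  split_ifs <;> simp

/-- The trivial one-dimensional module. -/
@[reducible] def unit : ChainAction I G where
  cpx := FinComplex.unit
  act := (counit I G).smulRight 1

lemma sgn_sgn (X : FinComplex) (p q : ℤ) (v : X.carrier) :
    X.sgn p (X.sgn q v) = X.sgn (p + q) v := by
  have : X.sgn p ∘ₗ X.sgn q = X.sgn (p + q) := FinComplex.hom_ext X fun n v hv => by
    simp [X.sgn_of_mem _ hv, smul_smul, add_mul, zpow_add₀, mul_comm ((-1 : ℝ) ^ (q * n))]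
  exact LinearMap.congr_fun this v

lemma sgn_zero (X : FinComplex) : X.sgn 0 = 1 := FinComplex.hom_ext X fun n v hv => by
  simp [X.sgn_of_mem _ hv]

def tensorHom {V W V' W' : ChainAction I G} (f : V ⟶ W) (g : V' ⟶ W') :
    V.tensor V' ⟶ W.tensor W' where
  hom := FinComplex.tensorHom f.hom g.hom
  equivariant := equivariant_of_chain (V := V.tensor V') (W := W.tensor W') fun k σ => by
    refine TensorProduct.ext' fun v w => ?_
    rw [tensor_act_chain, tensor_act_chain]
    simp only [FinComplex.tensorHom, LinearMap.comp_apply, LinearMap.sum_apply,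
      TensorProduct.map_tmul, map_sum, Hom.equivariant_apply, FinComplex.Hom.map_sgn]

def associator (U V W : ChainAction I G) : (U.tensor V).tensor W ≅ U.tensor (V.tensor W) :=
  isoMk (FinComplex.associator U.cpx V.cpx W.cpx) <| equivariant_of_chain fun k σ => by
    refine TensorProduct.ext_threefold fun u v w => ?_
    change TensorProduct.assoc ℝ U.cpx.carrier V.cpx.carrier W.cpx.carrier
      (((U.tensor V).tensor W).act (chain σ) ((u ⊗ₜ v) ⊗ₜ w)) =
      (U.tensor (V.tensor W)).act (chain σ) (u ⊗ₜ (v ⊗ₜ w))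
    rw [tensor_act_apply (U.tensor V) W, tensor_act_apply U (V.tensor W), map_sum]
    have hl : ∀ i : Fin (k + 1), TensorProduct.assoc ℝ U.cpx.carrier V.cpx.carrier W.cpx.carrier
        ((U.tensor V).act (chain (front σ i)) ((U.tensor V).cpx.sgn (-((k - i.val : ℕ) : ℤ))
          (u ⊗ₜ v)) ⊗ₜ W.act (chain (back σ i)) w) =
        ∑ j : Fin (i.val + 1), U.act (chain (front (front σ i) j))
          (U.cpx.sgn (-((k - j.val : ℕ) : ℤ)) u) ⊗ₜ
            (V.act (chain (back (front σ i) j)) (V.cpx.sgn (-((k - i.val : ℕ) : ℤ)) v) ⊗ₜ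
              W.act (chain (back σ i)) w) := by
      intro i
      rw [FinComplex.sgn_tmul, tensor_act_apply, TensorProduct.sum_tmul, map_sum]
      refine Finset.sum_congr rfl fun j _ => ?_
      rw [sgn_sgn, TensorProduct.assoc_tmul]
      congr 4
      omega
    have hr : ∀ a : Fin (k + 1), U.act (chain (front σ a)) (U.cpx.sgn (-((k - a.val : ℕ) : ℤ)) u)
        ⊗ₜ[ℝ] (V.tensor W).act (chain (back σ a)) (v ⊗ₜ w) =
        ∑ b : Fin (k - a.val + 1), U.act (chain (front σ a))
          (U.cpx.sgn (-((k - a.val : ℕ) : ℤ)) u) ⊗ₜ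
            (V.act (chain (front (back σ a) b)) (V.cpx.sgn (-((k - a.val - b.val : ℕ) : ℤ)) v) ⊗ₜ
              W.act (chain (back (back σ a) b)) w) := by
      intro a
      rw [tensor_act_apply, TensorProduct.tmul_sum]
    rw [Finset.sum_congr rfl fun i _ => hl i, Finset.sum_congr rfl fun a _ => hr a,
      Finset.sum_sigma', Finset.sum_sigma']
    refine Finset.sum_bij' (fun x _ => ⟨⟨x.2.val, by omega⟩, ⟨x.1.val - x.2.val, by grind⟩⟩)
      (fun y _ => ⟨⟨y.1.val + y.2.val, by grind⟩, ⟨y.1.val, by grind⟩⟩)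
      (by simp) (by simp) ?_ ?_ ?_
    · rintro ⟨i, j⟩ _
      have h : j.val + (i.val - j.val) = i.val := by omega
      exact Sigma.ext (Fin.ext h) ((Fin.heq_ext_iff (by simp [h])).2 rfl)
    · rintro ⟨a, b⟩ _
      have h : a.val + b.val - a.val = b.val := by omega
      exact Sigma.ext (Fin.ext rfl) (heq_of_eq (Fin.ext h))
    · rintro ⟨i, j⟩ _
      have h1 : chain (front (front σ i) j) = chain (front σ ⟨j.val, by omega⟩) := by
        rw [front, front, subface_subface]
        exact chain_subface_congr σ rfl (by simp)
      have h2 : chain (back (front σ i) j) =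
          chain (front (back σ ⟨j.val, by omega⟩) ⟨i.val - j.val, by grind⟩) := by
        rw [front, front, back, back, subface_subface, subface_subface]
        exact chain_subface_congr σ rfl (by simp)
      have h3 : chain (back σ i) =
          chain (back (back σ ⟨j.val, by omega⟩) ⟨i.val - j.val, by grind⟩) := by
        rw [back, back, back, subface_subface]
        exact chain_subface_congr σ (by grind) (by grind)
      have h4 : k - j.val - (i.val - j.val) = k - i.val := by omega
      simp only [h1, h2, h3, h4]

def leftUnitor (V : ChainAction I G) : unit.tensor V ≅ V :=
  isoMk (FinComplex.leftUnitor V.cpx) <| equivariant_of_chain fun k σ => by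
    refine TensorProduct.ext' fun (u : ℝ) v => ?_
    change TensorProduct.lid ℝ V.cpx.carrier ((unit.tensor V).act (chain σ) (u ⊗ₜ v)) =
      V.act (chain σ) (u • v)
    rw [tensor_act_apply, map_sum, Finset.sum_eq_single 0]
    · rw [FinComplex.sgn_unit, unit_act_apply, Module.End.one_apply, TensorProduct.lid_tmul,
        map_smul]
      have : back σ 0 = σ := subface_id σ
      rw [if_pos (by simp), this]
      rfl
    · intro b _ hb
      have hb' : b.val ≠ 0 := fun h => hb (Fin.ext h)
      rw [FinComplex.sgn_unit, unit_act_apply, if_neg hb']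
      simp
    · simp

def rightUnitor (V : ChainAction I G) : V.tensor unit ≅ V :=
  isoMk (FinComplex.rightUnitor V.cpx) <| equivariant_of_chain fun k σ => by
    refine TensorProduct.ext' fun v (u : ℝ) => ?_
    change TensorProduct.rid ℝ V.cpx.carrier ((V.tensor unit).act (chain σ) (v ⊗ₜ u)) =
      V.act (chain σ) (u • v)
    rw [tensor_act_apply, map_sum, Finset.sum_eq_single (Fin.last k)]
    · have : front σ (Fin.last k) = σ := subface_id σ
      rw [unit_act_apply, if_pos (by simp), this, TensorProduct.rid_tmul]
      simp [sgn_zero]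
    · intro b _ hb
      rw [unit_act_apply, if_neg (by have := Fin.val_lt_last hb; omega)]
      simp
    · simp

instance : MonoidalCategoryStruct (ChainAction I G) where
  tensorObj := tensor
  tensorHom := tensorHom
  whiskerLeft V _ _ f := tensorHom (𝟙 V) f
  whiskerRight f V := tensorHom f (𝟙 V)
  tensorUnit := unit
  associator := associator
  leftUnitor := leftUnitor
  rightUnitor := rightUnitor

instance : MonoidalCategory (ChainAction I G) :=
  Monoidal.induced (forget I G)
    { μIso _ _ := .refl _
      εIso := .refl _
      whiskerLeft_eq _ _ _ _ := by ext1; exact TensorProduct.ext rfl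
      whiskerRight_eq _ _ := by ext1; exact TensorProduct.ext rfl
      tensorHom_eq _ _ := by ext1; exact TensorProduct.ext rfl
      associator_eq _ _ _ := by ext1; exact TensorProduct.ext (TensorProduct.ext rfl)
      leftUnitor_eq _ := by ext1; exact TensorProduct.ext rfl
      rightUnitor_eq _ := by ext1; exact TensorProduct.ext rfl }

end ChainAction

variable [LieGroup I ∞ G]

/-- The simplex `μ ∘ (σ × ν) ∘ χ_*` in `G`, of dimension `r + s`. -/
def shuffleSimplex {r s : ℕ} (σ : Simplex I G r) (ν : Simplex I G s) (χ : Shuffle r s) :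
    Simplex I G (r + s) :=
  (σ.pull (coordMap fun i => χ.1 (Fin.castAdd s i)) (contDiff_coordMap _)
      (coordMap_mem χ.2.1)).mul
    (ν.pull (coordMap fun i => χ.1 (Fin.natAdd r i)) (contDiff_coordMap _) (coordMap_mem χ.2.2))

open Classical in
variable (I G) in
/-- The product of chains: the Eilenberg-Zilber shuffle map followed by the multiplication
of `G`. -/
def chainMul : Chain I G →ₗ[ℝ] Chain I G →ₗ[ℝ] Chain I G :=
  Chain.lift I G fun _ σ => Chain.lift I G fun _ ν =>
    ∑ χ : Shuffle _ _, ((Equiv.Perm.sign χ.1 : ℤ) : ℝ) • chain (shuffleSimplex σ ν χ)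

end

section

variable {E : Type*} [NormedAddCommGroup E] [NormedSpace ℝ E]
  {H : Type*} [TopologicalSpace H] {I : ModelWithCorners ℝ E H}
  {G : Type*} [TopologicalSpace G] [ChartedSpace H G]

/-! ### The exponential map -/

/-- Integral curves of smooth vector fields are smooth. -/
lemma contMDiff_of_isMIntegralCurve [IsManifold I ∞ G] [BoundarylessManifold I G]
    {v : (x : G) → TangentSpace I x}
    (hv : ContMDiff I I.tangent ∞ (fun x => (⟨x, v x⟩ : TangentBundle I G)))
    {γ : ℝ → G} (hγ : IsMIntegralCurve γ v) : ContMDiff 𝓘(ℝ) I ∞ γ := by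
  have key : ∀ n : ℕ, ContMDiff 𝓘(ℝ) I n γ := by
    intro n
    induction n with
    | zero => exact contMDiff_zero_iff.2 hγ.continuous
    | succ n ih =>
      intro t₀
      rw [contMDiffAt_iff_target]
      refine ⟨hγ.continuous.continuousAt, ?_⟩
      have hv' := (contMDiffAt_iff.1 (hv.contMDiffAt (x := γ t₀))).2
      set v' : E → E := fun x =>
        tangentCoordChange I ((extChartAt I (γ t₀)).symm x) (γ t₀)
          ((extChartAt I (γ t₀)).symm x) (v ((extChartAt I (γ t₀)).symm x)) with hv'def
      have hvs : ContDiffAt ℝ ∞ v' (extChartAt I (γ t₀) (γ t₀)) :=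
        (hv'.contDiffAt (range_mem_nhds_isInteriorPoint
          BoundarylessManifold.isInteriorPoint)).snd
      have ihc : ContDiffAt ℝ n (extChartAt I (γ t₀) ∘ γ) t₀ := by
        have := (contMDiffAt_iff_target.1 (ih t₀)).2
        exact this.contDiffAt
      rw [contMDiffAt_iff_contDiffAt]
      have hsrc : ∀ᶠ t in nhds t₀, γ t ∈ (extChartAt I (γ t₀)).source :=
        hγ.continuous.continuousAt.preimage_mem_nhds (extChartAt_source_mem_nhds (γ t₀))
      have hd := (hγ.isMIntegralCurveAt t₀).eventually_hasDerivAt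
      refine contDiffAt_succ_iff_hasFDerivAt.2
        ⟨fun t => (1 : ℝ →L[ℝ] ℝ).smulRight (v' ((extChartAt I (γ t₀) ∘ γ) t)), ?_, ?_⟩
      · obtain ⟨u, hu, h⟩ := (hsrc.and hd).exists_mem
        refine ⟨u, hu, fun t ht => ?_⟩
        have h2 := (h t ht).2
        refine (h2.congr_deriv (g' := v' ((extChartAt I (γ t₀) ∘ γ) t)) ?_).hasFDerivAt
        rw [hv'def]
        congr <;> rw [Function.comp_apply, PartialEquiv.left_inv _ (h t ht).1]
      · have h1 : ContDiffAt ℝ n (fun t => v' ((extChartAt I (γ t₀) ∘ γ) t)) t₀ :=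
          ContDiffAt.comp (g := v') t₀ (hvs.of_le (mod_cast le_top)) ihc
        exact contDiffAt_const.smulRight h1
  exact contMDiff_infty.2 key

variable [Group G] [LieGroup I ∞ G]

instance lieGroup_minSmoothness : LieGroup I (minSmoothness ℝ 3) G :=
  LieGroup.of_le (m := minSmoothness ℝ 3) (n := ∞) (by simp; exact ENat.LEInfty.out)

/-- Left-invariant vector fields are smooth. -/
lemma contMDiff_invariantField (x : GroupLieAlgebra I G) : ContMDiff I I.tangent ∞
    (fun g : G => (mulInvariantVectorField x g : TangentBundle I G)) := by
  let fg : G → TangentBundle I G := fun g => Bundle.TotalSpace.mk' E g 0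
  have sfg : ContMDiff I I.tangent ∞ fg := Bundle.contMDiff_zeroSection _ _
  let fv : G → TangentBundle I G := fun _ => Bundle.TotalSpace.mk' E 1 x
  have sfv : ContMDiff I I.tangent ∞ fv := contMDiff_const
  let F₁ : G → (TangentBundle I G × TangentBundle I G) := fun g => (fg g, fv g)
  have S₁ : ContMDiff I (I.tangent.prod I.tangent) ∞ F₁ := sfg.prodMk sfv
  let F₂ : (TangentBundle I G × TangentBundle I G) → TangentBundle (I.prod I) (G × G) :=
    (equivTangentBundleProd I G I G).symm
  have S₂ : ContMDiff (I.tangent.prod I.tangent) (I.prod I).tangent ∞ F₂ :=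
    contMDiff_equivTangentBundleProd_symm
  let F₃ : TangentBundle (I.prod I) (G × G) → TangentBundle I G :=
    tangentMap (I.prod I) I (fun p : G × G => p.1 * p.2)
  have S₃ : ContMDiff (I.prod I).tangent I.tangent ∞ F₃ :=
    ContMDiff.contMDiff_tangentMap (contMDiff_mul I ∞) (by simp)
  refine ((S₃.comp S₂).comp S₁).congr fun g => ?_
  refine Bundle.TotalSpace.ext (by simp [F₁, F₂, F₃, fg, fv]) (heq_of_eq ?_)
  have h := mfderiv_prod_eq_add_apply (I := I) (I' := I) (I'' := I)
    (v := ((0, x) : TangentSpace I g × TangentSpace I (1 : G)))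
    ((contMDiff_mul I ∞ (G := G)).mdifferentiable (by simp) (g, 1))
  rw [map_zero, zero_add] at h
  exact h.symm

/-- The one-parameter subgroup with velocity `x`: the integral curve through `1` of the
left-invariant vector field of `x` exists for all times. -/
lemma exists_oneParameter [CompleteSpace E] [I.Boundaryless] [T2Space G]
    (x : GroupLieAlgebra I G) :
    ∃ γ : ℝ → G, γ 0 = 1 ∧ IsMIntegralCurve γ (mulInvariantVectorField (I := I) x) := by
  have hv := (contMDiff_invariantField x).of_le (show (1 : ℕ∞ω) ≤ ∞ from ENat.LEInfty.out)
  obtain ⟨γ, h1, h2⟩ := exists_isMIntegralCurveAt_of_contMDiffAt_boundaryless 0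
    (hv.contMDiffAt (x := 1))
  obtain ⟨ε, hε, h2⟩ := isMIntegralCurveAt_iff'.1 h2
  refine exists_isMIntegralCurve_of_isMIntegralCurveOn hv hε (fun g => ?_) 1
  refine ⟨fun t => g * γ t, by simp [h1], fun t ht => ?_⟩
  have h3 := h2 t (by simpa [Real.ball_eq_Ioo] using ht)
  have h4 : HasMFDerivAt I I (g * ·) (γ t) (mfderiv I I (g * ·) (γ t)) :=
    ((contMDiff_mul_left (I := I) (n := ∞) (a := g)).mdifferentiable (by simp) (γ t)).hasMFDerivAt
  rw [show Ioo (-ε) ε = Metric.ball 0 ε by simp [Real.ball_eq_Ioo]]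
  have h5 := h4.comp_hasMFDerivWithinAt t h3
  have h6 : mulInvariantVectorField x (g * γ t) =
      mfderiv I I (g * ·) (γ t) (mulInvariantVectorField x (γ t)) := by
    have e : (fun z : G => g * γ t * z) = (g * ·) ∘ (γ t * ·) := by
      ext z
      simp [mul_assoc]
    have h7 := mfderiv_comp_apply (I := I) (I' := I) (I'' := I) (f := (γ t * ·)) (g := (g * ·))
      (x := (1 : G))
      ((contMDiff_mul_left (I := I) (n := ∞) (a := g)).mdifferentiable (by simp) _)
      ((contMDiff_mul_left (I := I) (n := ∞) (a := γ t)).mdifferentiable (by simp) 1) x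
    have h8 := congrArg (fun f : G → G => (show E →L[ℝ] E from mfderiv I I f 1) x) e
    have h9 := congrArg (fun p : G => (show E →L[ℝ] E from mfderiv I I (g * ·) p)
      (mulInvariantVectorField x (γ t))) (mul_one (γ t))
    exact h8.trans (h7.trans h9)
  refine h5.congr_mfderiv (ContinuousLinearMap.ext fun r => ?_)
  exact (map_smul (mfderiv I I (g * ·) (γ t)) (show ℝ from r) (mulInvariantVectorField x (γ t))).trans
    (congrArg (fun w : E => (show ℝ from r) • w) h6.symm)

/-- The exponential map of `G`. -/
def lieExp [CompleteSpace E] [I.Boundaryless] [T2Space G] (x : GroupLieAlgebra I G) : G :=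
  (exists_oneParameter x).choose 1

lemma lieExp_smul [CompleteSpace E] [I.Boundaryless] [T2Space G] (x : GroupLieAlgebra I G)
    (t : ℝ) : lieExp (t • x) = (exists_oneParameter x).choose t := by
  have h := (exists_oneParameter (t • x)).choose_spec
  have h' := (exists_oneParameter x).choose_spec
  have hv := (contMDiff_invariantField (t • x)).of_le
    (show (1 : ℕ∞ω) ≤ ∞ from ENat.LEInfty.out)
  have h2 := h'.2.comp_mul t
  rw [← mulInvariantVectorField_smul] at h2
  have := isMIntegralCurve_Ioo_eq_of_contMDiff_boundaryless (t₀ := 0) hv h.2 h2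
    (by simp [h.1, h'.1])
  exact (congrFun this 1).trans (congrArg _ (one_mul t))

lemma contMDiff_lieExp_smul [CompleteSpace E] [I.Boundaryless] [T2Space G]
    (x : GroupLieAlgebra I G) : ContMDiff 𝓘(ℝ) I ∞ fun t : ℝ => lieExp (t • x) := by
  simp only [lieExp_smul]
  exact contMDiff_of_isMIntegralCurve (contMDiff_invariantField x)
    (exists_oneParameter x).choose_spec.2

end
/-! ### The category of smooth modules over the chains -/

section

variable {E : Type*} [NormedAddCommGroup E] [NormedSpace ℝ E]
  {H : Type*} [TopologicalSpace H] {I : ModelWithCorners ℝ E H}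
  {G : Type*} [TopologicalSpace G] [ChartedSpace H G] [Group G]

/-- A `k`-simplex is thin if its differential has rank less than `k` at every point. -/
def IsThin {k : ℕ} (σ : Simplex I G k) : Prop :=
  ∀ t ∈ stdSimp k, Module.finrank ℝ
    (mfderivWithin 𝓘(ℝ, Fin k → ℝ) I σ.ext' (stdSimp k) t).toLinearMap.range < k

/-- A family `(s p)` of simplices, indexed by the points of a manifold `M`, such that the map
`M × Δ_k → G`, `(p, t) ↦ s p t`, is smooth. -/
def IsSmoothFamily {n : ℕ} {M : Type} [TopologicalSpace M]
    [ChartedSpace (EuclideanSpace ℝ (Fin n)) M] {k : ℕ} (s : M → Simplex I G k) : Prop :=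
  ContMDiffOn ((𝓡 n).prod 𝓘(ℝ, Fin k → ℝ)) I ∞
    (fun q : M × (Fin k → ℝ) => (s q.1).ext' q.2) (univ ×ˢ stdSimp k)

/-- The cubical cochain `τ(c)(θ) = ∑_χ sgn(χ) c(θ ∘ χ_*)` of a singular cochain `c`. -/
def tau {k : ℕ} (c : Simplex I G k → ℝ) (θ : Cube I G k) : ℝ :=
  ∑ χ : Equiv.Perm (Fin k), ((Equiv.Perm.sign χ : ℤ) : ℝ) *
    c (θ.pull (coordMap χ) (contDiff_coordMap _)
      ((coordMap_mem_cube χ).mono_left (stdSimp_subset_stdCube k)))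

/-- A singular cochain `c` is alternating if the cubical cochain `τ(c)` is. -/
def IsAlternating {k : ℕ} (c : Simplex I G k → ℝ) : Prop :=
  ∀ (χ : Equiv.Perm (Fin k)) (θ : Cube I G k),
    tau c (θ.pull (coordMap χ) (contDiff_coordMap _) (coordMap_mem_cube χ)) =
      ((Equiv.Perm.sign χ : ℤ) : ℝ) * tau c θ

/-- An affine triangulation of the cube `I^k` by a finite simplicial complex with totally ordered
vertex set `{0, …, m - 1}`. -/
structure AffineTriangulation (k : ℕ) where
  m : ℕ
  vert : Fin m → Fin k → ℝ
  vert_mem : ∀ i, vert i ∈ stdCube k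
  faces : Finset (Finset (Fin m))
  down_closed : ∀ s ∈ faces, ∀ s' ⊆ s, s' ∈ faces
  indep : ∀ s ∈ faces, AffineIndependent ℝ fun i : s => vert i
  inter : ∀ s ∈ faces, ∀ s' ∈ faces, convexHull ℝ (vert '' s) ∩ convexHull ℝ (vert '' s') =
    convexHull ℝ (vert '' (s ∩ s' : Finset (Fin m)))
  cover : ⋃ s ∈ faces, convexHull ℝ (vert '' s) = stdCube k

namespace AffineTriangulation

variable {k : ℕ} (T : AffineTriangulation k)

/-- The simplices of top dimension. -/
def top : Finset (Finset (Fin T.m)) := T.faces.filter fun s => s.card = k + 1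

/-- The vertices of a top simplex, in increasing order. -/
def corner (s : T.top) (i : Fin (k + 1)) : Fin k → ℝ :=
  T.vert (s.1.orderEmbOfFin (Finset.mem_filter.1 s.2).2 i)

/-- The orientation sign of a top simplex: the sign of the determinant of the linear part of the
affine map `Δ_k → I^k` that parametrizes it. -/
def orient (s : T.top) : ℝ :=
  SignType.sign (Matrix.of fun i j : Fin k => (T.corner s j.succ - T.corner s j.castSucc) i).det

lemma affineMap_corner_mem (s : T.top) :
    MapsTo (affineMap (T.corner s)) (stdSimp k) (stdCube k) := fun _ ht =>
  affineMap_mem (convex_stdCube k) (fun _ => T.vert_mem _) ht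

end AffineTriangulation

/-- A singular cochain `c` is subdivision invariant if
`τ(c)(θ) = ∑_σ sgn(σ) c(θ ∘ σ)` for every cube `θ` and every affine triangulation of `I^k`, where
`σ` runs over the `k`-simplices of the triangulation. -/
def IsSubdivisionInvariant {k : ℕ} (c : Simplex I G k → ℝ) : Prop :=
  ∀ (T : AffineTriangulation k) (θ : Cube I G k), tau c θ = ∑ s : T.top, T.orient s *
    c (θ.pull (affineMap (T.corner s)) (contDiff_affineMap _) (T.affineMap_corner_mem s))

variable [LieGroup I ∞ G]

/-- The action makes the complex a left DG module over the DG algebra `C_•(G)`, where `k`-chains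
have degree `-k`. -/
structure IsDGModule (V : ChainAction I G) : Prop where
  degree : ∀ (k : ℕ) (σ : Simplex I G k) (n : ℤ), ∀ v ∈ V.cpx.gr n,
    V.act (chain σ) v ∈ V.cpx.gr (n - k)
  one : V.act (chain (pointSimplex I (1 : G))) = 1
  mul : ∀ a b : Chain I G, V.act (chainMul I G a b) = V.act a * V.act b
  differential : ∀ (k : ℕ) (σ : Simplex I G k), V.act (boundary I G (chain σ)) =
    V.cpx.d * V.act (chain σ) - (-1 : ℝ) ^ k • (V.act (chain σ) * V.cpx.d)

/-- The property that defines `Mod(C_•(G))`: finite-dimensional DG modules whose action vanishes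
on thin simplices, is smooth, and has alternating and subdivision invariant matrix
coefficients. -/
structure IsSmoothModule (V : ChainAction I G) : Prop extends IsDGModule V where
  thin : ∀ (k : ℕ) (σ : Simplex I G k), IsThin σ → V.act (chain σ) = 0
  smooth : ∀ (n : ℕ) (M : Type) [TopologicalSpace M] [ChartedSpace (EuclideanSpace ℝ (Fin n)) M]
    [IsManifold (𝓡 n) ∞ M] [T2Space M] [SecondCountableTopology M] (k : ℕ)
    (s : M → Simplex I G k), IsSmoothFamily (n := n) s →
      ∀ (f : Module.Dual ℝ V.cpx.carrier) (v : V.cpx.carrier),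
        ContMDiff (𝓡 n) 𝓘(ℝ) ∞ fun p => f (V.act (chain (s p)) v)
  alternating : ∀ (k : ℕ) (f : Module.Dual ℝ V.cpx.carrier) (v : V.cpx.carrier),
    IsAlternating fun σ : Simplex I G k => f (V.act (chain σ) v)
  subdivision : ∀ (k : ℕ) (f : Module.Dual ℝ V.cpx.carrier) (v : V.cpx.carrier),
    IsSubdivisionInvariant fun σ : Simplex I G k => f (V.act (chain σ) v)

variable (I G) in
/-- The objects of `Mod(C_•(G))`. -/
def smoothModules : ObjectProperty (ChainAction I G) := IsSmoothModule

/-- The smallest class of complexes with an action of `C_•(G)` that contains `Mod(C_•(G))` and the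
trivial module and is closed under tensor products. -/
inductive IsTensorGenerated : ChainAction I G → Prop
  | of_smooth (V : ChainAction I G) : IsSmoothModule V → IsTensorGenerated V
  | unit : IsTensorGenerated ChainAction.unit
  | tensor (V W : ChainAction I G) : IsTensorGenerated V → IsTensorGenerated W →
      IsTensorGenerated (V.tensor W)

variable (I G) in
/-- The monoidal category generated by `Mod(C_•(G))`. -/
def tensorClosure : ObjectProperty (ChainAction I G) := IsTensorGenerated

instance : (tensorClosure I G).IsMonoidal where
  prop_unit := IsTensorGenerated.unit
  prop_tensor _ _ := IsTensorGenerated.tensor _ _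

lemma smoothModules_le_tensorClosure : smoothModules I G ≤ tensorClosure I G :=
  fun V hV => IsTensorGenerated.of_smooth V hV

/-! ### Differentiation -/

/-- `A` is the derivative at `0` of a curve of operators on a finite-dimensional vector space. -/
def HasOpDerivAtZero {W : Type*} [AddCommGroup W] [Module ℝ W] (F : ℝ → Module.End ℝ W)
    (A : Module.End ℝ W) : Prop :=
  ∀ (f : Module.Dual ℝ W) (v : W), HasDerivAt (fun t => f (F t v)) (f (A v)) 0

variable [CompleteSpace E] [I.Boundaryless] [T2Space G]

/-- The `1`-simplex `σ[x]`, `s ↦ exp (s x)`. -/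
def expSimplex (x : GroupLieAlgebra I G) : Simplex I G 1 :=
  SmoothMapOn.ofFun (fun s => lieExp (s 0 • x))
    ((contMDiff_lieExp_smul x).comp (contDiff_apply ℝ ℝ (0 : Fin 1)).contMDiff).contMDiffOn

/-- `R` is obtained from the action `ρ` of the chains by differentiation:
`R(L_x) = d/dt ρ(exp (t x))` and `R(i_x) = d/dt ρ(σ[t x])` at `t = 0`. -/
def IsDerivative (V : ChainAction I G)
    (R : DGLieRep (cartanAlg (GroupLieAlgebra I G)) V.cpx) : Prop :=
  ∀ x : GroupLieAlgebra I G,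
    HasOpDerivAtZero (fun t : ℝ => V.act (chain (pointSimplex I (lieExp (t • x)))))
      (R.act (elemL x)) ∧
    HasOpDerivAtZero (fun t : ℝ => V.act (chain (expSimplex (t • x)))) (R.act (elemI x))

/-- The functor to representations of `T𝔤` that equips the complexes underlying a class of
complexes with an action of `C_•(G)` with given representations `R`, and is the identity on the
linear maps underlying the morphisms. -/
def repFunctor (P : ObjectProperty (ChainAction I G))
    (R : ∀ V : P.FullSubcategory, DGLieRep (cartanAlg (GroupLieAlgebra I G)) V.obj.cpx)
    (hR : ∀ (V W : P.FullSubcategory) (φ : V ⟶ W) x,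
      φ.hom.hom.toLin ∘ₗ (R V).act x = (R W).act x ∘ₗ φ.hom.hom.toLin) :
    P.FullSubcategory ⥤ Rep (cartanAlg (GroupLieAlgebra I G)) where
  obj V := ⟨V.obj.cpx, R V⟩
  map φ := ⟨φ.hom.hom, hR _ _ φ⟩

end

end LieChains
end

open LieChains

/-! Write ρ for the action. Everything reduces to a linear map α from the Lie algebra to End V: `α
x` is the derivative at `t = 0` of ρ on the paths `s ↦ γ (t s)`, for any smooth curve γ through 1
with velocity x. Then i_x acts by `α x`, and L_x by the graded commutator `[d, α x]`.

That α exists and is linear (`IsSmoothModule.exists_pathDerivative`) is a statement of calculus. In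
a chart at 1 the straight paths `s ↦ s y` depend smoothly on the vector y, so ρ on them has a
differential at `y = 0`, and this differential is α. Hadamard's lemma writes a general curve as `t
r(t)`. The paths `s ↦ a s r(b s)` then join γ, seen on the diagonal `a = b = t`, to the straight
paths, at `b = 0`. They are constant at `a = 0`, so only `r 0` contributes.

The relations come from geometry. The boundary of σ[tx] is `exp (t x) - 1`, whence `L_x = [d, i_x]`.
The square of i_x vanishes because a product of two paths in one one-parameter subgroup is a sum of
thin 2-simplices; polarization gives `[i_x, i_y] = 0`. Conjugation by `exp (s x)` carries paths
through 1 to paths through 1 and acts on velocities by Ad; its derivative at `s = 0` is `[L_x, i_y]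
= i_[x,y]` (`IsPathDerivative.map_lie`), by way of `hasDerivAt_conj_lieExp`. Applying `[d, -]` gives
`[L_x, L_y] = L_[x,y]`.

For tensor products, points are group-like, and the coproduct of a path γ is `γ(0) ⊗ γ + γ ⊗ γ(1)`.
The Leibniz rule turns these formulas into the tensor product action of the DG Lie algebra
(`IsDerivative.tensor`). Since derivatives are unique, functoriality is automatic, and the
representation on V ⊗ W is the tensor product of representations itself, so that identities serve as
structure isomorphisms. -/

noncomputable section
namespace LieChains

/-! ### Calculus of operator-valued curves -/

namespace HasOpDerivAtZero

variable {W : Type*} [AddCommGroup W] [Module ℝ W] {F F' : ℝ → Module.End ℝ W}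
  {A A' : Module.End ℝ W}

lemma congr (h : HasOpDerivAtZero F A) (hF : ∀ t, F' t = F t) : HasOpDerivAtZero F' A := by
  obtain rfl : F' = F := funext hF
  exact h

lemma const (B : Module.End ℝ W) : HasOpDerivAtZero (fun _ => B) 0 := fun f v => by
  simpa using hasDerivAt_const (0 : ℝ) (f (B v))

lemma add (h : HasOpDerivAtZero F A) (h' : HasOpDerivAtZero F' A') :
    HasOpDerivAtZero (fun t => F t + F' t) (A + A') := fun f v => by
  simpa using! (h f v).add (h' f v)

lemma const_mul (B : Module.End ℝ W) (h : HasOpDerivAtZero F A) :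
    HasOpDerivAtZero (fun t => B * F t) (B * A) := fun f v => h (f ∘ₗ B) v

lemma mul_const (h : HasOpDerivAtZero F A) (B : Module.End ℝ W) :
    HasOpDerivAtZero (fun t => F t * B) (A * B) := fun f v => h f (B v)

/-- Derivatives are tested on matrix coefficients only, so no norm on `W` is needed; linear
functionals separate the vectors `A v` and `A' v`. -/
lemma unique (h : HasOpDerivAtZero F A) (h' : HasOpDerivAtZero F A') : A = A' := by
  ext v
  refine (Module.forall_dual_apply_eq_zero_iff ℝ (A v - A' v)).1 (fun f => ?_) |> sub_eq_zero.1
  rw [map_sub, (h f v).unique (h' f v), sub_self]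

/-- The Leibniz rule for a bilinear composition of operators, in terms of a basis. -/
lemma mul [FiniteDimensional ℝ W] (h : HasOpDerivAtZero F A) (h' : HasOpDerivAtZero F' A') :
    HasOpDerivAtZero (fun t => F t * F' t) (A * F' 0 + F 0 * A') := fun f v => by
  let b := Module.finBasis ℝ W
  -- Inserting a basis between the factors makes the coefficient a finite sum of products of scalar
  -- functions.
  have e : ∀ (B C : Module.End ℝ W), f ((B * C) v) = ∑ i, f (B (b i)) * b.coord i (C v) := by
    intro B C
    conv_lhs => rw [Module.End.mul_apply, ← b.sum_repr (C v)]
    simp only [map_sum, map_smul, smul_eq_mul, b.coord_apply, mul_comm]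
  simp only [LinearMap.add_apply, map_add, e, ← Finset.sum_add_distrib]
  exact HasDerivAt.fun_sum fun i _ => (h f (b i)).mul (h' (b.coord i) v)

/-- A subspace is the common kernel of the functionals that vanish on it, and for these the
coefficient is constantly 0. Used with `S` a homogeneous component, this gives the degree of the
derivative. -/
lemma apply_mem (h : HasOpDerivAtZero F A) {v : W} {S : Submodule ℝ W} (hF : ∀ t, F t v ∈ S) :
    A v ∈ S := by
  rw [← Subspace.forall_mem_dualAnnihilator_apply_eq_zero_iff]
  intro f hf
  have h0 : (fun t => f (F t v)) = fun _ => 0 :=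
    funext fun t => (Submodule.mem_dualAnnihilator f).1 hf _ (hF t)
  have h1 := h f v
  rw [h0] at h1
  exact h1.unique (hasDerivAt_const _ _)

/-- Derivatives are natural with respect to intertwining maps. -/
lemma intertwine {W' : Type*} [AddCommGroup W'] [Module ℝ W']
    {F' : ℝ → Module.End ℝ W'} {A' : Module.End ℝ W'} (h : HasOpDerivAtZero F A)
    (h' : HasOpDerivAtZero F' A') {φ : W →ₗ[ℝ] W'} (hφ : ∀ t, φ ∘ₗ F t = F' t ∘ₗ φ) :
    φ ∘ₗ A = A' ∘ₗ φ := by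
  ext v
  refine (Module.forall_dual_apply_eq_zero_iff ℝ ((φ ∘ₗ A) v - (A' ∘ₗ φ) v)).1 (fun f => ?_)
    |> sub_eq_zero.1
  have h1 := h (f ∘ₗ φ) v
  have h2 := h' f (φ v)
  have e : (fun t => (f ∘ₗ φ) (F t v)) = fun t => f (F' t (φ v)) :=
    funext fun t => congrArg f (LinearMap.congr_fun (hφ t) v)
  rw [e] at h1
  rw [map_sub, sub_eq_zero]
  exact h1.unique h2

/-- The Leibniz rule for tensor products of operators. -/
lemma map [FiniteDimensional ℝ W] {W' : Type*} [AddCommGroup W'] [Module ℝ W']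
    {F' : ℝ → Module.End ℝ W'} {A' : Module.End ℝ W'} (h : HasOpDerivAtZero F A)
    (h' : HasOpDerivAtZero F' A') :
    HasOpDerivAtZero (W := W ⊗[ℝ] W') (fun t => TensorProduct.map (F t) (F' t))
      (TensorProduct.map A (F' 0) + TensorProduct.map (F 0) A') := fun f z => by
  induction z using TensorProduct.induction_on with
  | zero => simpa using hasDerivAt_const (0 : ℝ) (0 : ℝ)
  | add z z' hz hz' =>
    simp only [map_add]
    exact hz.add hz'
  | tmul v w =>
    let b := Module.finBasis ℝ W
    -- Expanding the left factor in a basis is enough; what remains is a functional on `W'`.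
    have e : ∀ (B : Module.End ℝ W) (C : Module.End ℝ W'),
        f (TensorProduct.map B C (v ⊗ₜ w)) =
          ∑ i, b.coord i (B v) * (f ∘ₗ TensorProduct.mk ℝ W W' (b i)) (C w) := by
      intro B C
      conv_lhs => rw [TensorProduct.map_tmul, ← b.sum_repr (B v)]
      simp only [TensorProduct.sum_tmul, ← TensorProduct.smul_tmul', map_sum, map_smul,
        smul_eq_mul, b.coord_apply, LinearMap.comp_apply, TensorProduct.mk_apply]
    simp only [LinearMap.add_apply, map_add, e, ← Finset.sum_add_distrib]
    exact HasDerivAt.fun_sum fun i _ => (h (b.coord i) v).mul (h' _ w)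

end HasOpDerivAtZero

/-- An operator-valued map with differentiable matrix coefficients has a differential. -/
lemma exists_opFDeriv {W N : Type*} [AddCommGroup W] [Module ℝ W] [FiniteDimensional ℝ W]
    [NormedAddCommGroup N] [NormedSpace ℝ N] {P : N → Module.End ℝ W} {y : N}
    (hP : ∀ (f : Module.Dual ℝ W) (v : W), DifferentiableAt ℝ (fun z => f (P z v)) y) :
    ∃ α : N →ₗ[ℝ] Module.End ℝ W, ∀ (f : Module.Dual ℝ W) (v : W) (z : N),
      fderiv ℝ (fun z => f (P z v)) y z = f (α z v) := by
  let b := Module.finBasis ℝ W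
  -- The operator whose matrix entries in the basis `b` are the differentials of the matrix entries
  -- of `P`.
  refine ⟨(b.constr ℝ).toLinearMap ∘ₗ LinearMap.pi fun j => ∑ i,
    (fderiv ℝ (fun z => b.coord i (P z (b j))) y).toLinearMap.smulRight (b i), fun f v z => ?_⟩
  -- Any coefficient is a combination of matrix entries with coefficients that do not depend on the
  -- operator.
  have e : ∀ B : Module.End ℝ W, f (B v) =
      ∑ i, ∑ j, f (b i) * b.repr v j * b.coord i (B (b j)) := by
    intro B
    conv_lhs => rw [← b.sum_repr (B v), map_sum]
    refine Finset.sum_congr rfl fun i _ => ?_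
    conv_lhs => rw [← b.sum_repr v]
    simp only [map_sum, map_smul, Finsupp.coe_finsetSum, Finset.sum_apply, Finsupp.smul_apply,
      smul_eq_mul, Module.Basis.coord_apply, Finset.sum_mul]
    exact Finset.sum_congr rfl fun j _ => by ring
  have h : HasFDerivAt (fun z => f (P z v)) (∑ i, ∑ j, (f (b i) * b.repr v j) •
      fderiv ℝ (fun z => b.coord i (P z (b j))) y) y := by
    simp only [fun z => e (P z)]
    exact HasFDerivAt.fun_sum fun i _ => HasFDerivAt.fun_sum fun j _ =>
      (hP (b.coord i) (b j)).hasFDerivAt.const_mul _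
  rw [h.fderiv, e]
  simp only [sum_apply, smul_apply, smul_eq_mul]
  refine Finset.sum_congr rfl fun i _ => Finset.sum_congr rfl fun j _ => ?_
  congr 1
  simp [Finsupp.single_apply]

/-! ### Simplices and their products -/

/-- The standard simplex has nonempty interior. -/
lemma uniqueDiffOn_stdSimp (k : ℕ) : UniqueDiffOn ℝ (stdSimp k) := by
  refine uniqueDiffOn_convex (convex_stdSimp k) ?_
  have ho : IsOpen {t : Fin k → ℝ | (∀ i j, i < j → t j < t i) ∧ ∀ i, 0 < t i ∧ t i < 1} := by
    simp only [ofPred_and, ofPred_forall]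
    refine IsOpen.inter ?_ ?_
    · exact isOpen_iInter_of_finite fun i => isOpen_iInter_of_finite fun j =>
        isOpen_iInter_of_finite fun _ => isOpen_lt (continuous_apply j) (continuous_apply i)
    · exact isOpen_iInter_of_finite fun i =>
        (isOpen_lt continuous_const (continuous_apply i)).inter
          (isOpen_lt (continuous_apply i) continuous_const)
  -- The interior point is (1/2, 1/3, 1/4, …), strictly decreasing and inside (0, 1).
  refine ⟨fun i => 1 / (i.val + 2 : ℝ), mem_interior.2 ⟨_, ?_, ho, fun i j hij => ?_, fun i => ?_⟩⟩
  · exact fun t ht => ⟨StrictAnti.antitone (fun i j hij => ht.1 i j hij),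
      fun i => ⟨(ht.2 i).1.le, (ht.2 i).2.le⟩⟩
  · have : (i.val : ℝ) < j.val := by exact_mod_cast hij
    exact one_div_lt_one_div_of_lt (by positivity) (by linarith)
  · have : (0 : ℝ) ≤ i.val := by positivity
    exact ⟨by positivity, by rw [div_lt_one (by positivity)]; linarith⟩

section

variable {E : Type*} [NormedAddCommGroup E] [NormedSpace ℝ E]
  {H : Type*} [TopologicalSpace H] {I : ModelWithCorners ℝ E H}
  {G : Type*} [TopologicalSpace G] [ChartedSpace H G] [Group G]

/-- A simplex that factors through a space of smaller dimension is thin. -/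
lemma isThin_of_factor {k : ℕ} {σ : Simplex I G k} {F : Type*} [NormedAddCommGroup F]
    [NormedSpace ℝ F] [FiniteDimensional ℝ F] (hF : Module.finrank ℝ F < k) {γ : F → G}
    (hγ : ContMDiff 𝓘(ℝ, F) I ∞ γ) {l : (Fin k → ℝ) → F} (hl : ContDiff ℝ ∞ l)
    (h : ∀ t : stdSimp k, σ.toFun t = γ (l t)) : IsThin σ := by
  intro t ht
  -- The factorization is known on the simplex only, as `ext'` takes the value 1 elsewhere. The
  -- derivative within the simplex sees no more than that, and it is unique by
  -- `uniqueDiffOn_stdSimp`.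
  have hc : ∀ t ∈ stdSimp k, σ.ext' t = (γ ∘ l) t := fun t ht =>
    (σ.ext'_apply ⟨t, ht⟩).trans (h ⟨t, ht⟩)
  have h1 : HasMFDerivWithinAt 𝓘(ℝ, Fin k → ℝ) I σ.ext' (stdSimp k) t
      ((mfderiv 𝓘(ℝ, F) I γ (l t)).comp (mfderiv 𝓘(ℝ, Fin k → ℝ) 𝓘(ℝ, F) l t)) := by
    have h2 := ((hγ.mdifferentiable (by simp) (l t)).hasMFDerivAt.comp t
      (hl.contMDiff.mdifferentiable (by simp) t).hasMFDerivAt).hasMFDerivWithinAt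
      (s := stdSimp k)
    exact h2.congr_of_eventuallyEq (eventually_mem_nhdsWithin.mono hc) (hc t ht)
  rw [h1.mfderivWithin (uniqueDiffOn_stdSimp k t ht).uniqueMDiffWithinAt]
  refine lt_of_le_of_lt ?_ hF
  -- Read as maps of vector spaces, the differential is `A ∘ₗ B` through `F`, so its rank is at most
  -- the dimension of `F`.
  let A : F →ₗ[ℝ] E := (mfderiv 𝓘(ℝ, F) I γ (l t)).toLinearMap
  let B : (Fin k → ℝ) →ₗ[ℝ] F := (mfderiv 𝓘(ℝ, Fin k → ℝ) 𝓘(ℝ, F) l t).toLinearMap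
  change Module.finrank ℝ (A ∘ₗ B).range ≤ _
  rw [LinearMap.range_comp]
  exact (Submodule.finrank_map_le _ _).trans (Submodule.finrank_le _)

/-- The `1`-simplex given by the restriction of a smooth path to `[0, 1]`. -/
def pathSimplex (γ : ℝ → G) (hγ : ContMDiff 𝓘(ℝ) I ∞ γ) : Simplex I G 1 :=
  SmoothMapOn.ofFun (fun s => γ (s 0)) (hγ.comp (contDiff_apply ℝ ℝ (0 : Fin 1)).contMDiff).contMDiffOn

lemma pathSimplex_congr {γ δ : ℝ → G} (hγ : ContMDiff 𝓘(ℝ) I ∞ γ) (hδ : ContMDiff 𝓘(ℝ) I ∞ δ)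
    (h : ∀ s ∈ Icc (0 : ℝ) 1, γ s = δ s) : pathSimplex γ hγ = pathSimplex δ hδ :=
  SmoothMapOn.ext (funext fun t => h _ (t.2.2 0))

/-- A constant path factors through a space of dimension 0. Hence σ[0] acts by zero on a smooth
module. -/
lemma isThin_pathSimplex_const (g : G) : IsThin (pathSimplex (I := I) (fun _ => g) contMDiff_const) :=
  isThin_of_factor (F := Fin 0 → ℝ) (γ := fun _ => g) (l := fun _ => 0) (by simp) contMDiff_const
    contDiff_const fun _ => rfl

lemma vertexMap_zero {k : ℕ} (α : Fin 1 → Fin (k + 1)) (t : Fin 0 → ℝ) :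
    vertexMap α t = vertex k (α 0) := by
  have h := sum_bary t
  rw [Fin.sum_univ_one] at h
  rw [vertexMap, affineMap, Fin.sum_univ_one, h, one_smul]

lemma subface_vertex {k : ℕ} (σ : Simplex I G k) (α : Fin 1 → Fin (k + 1)) :
    subface σ α = pointSimplex I (σ.ext' (vertex k (α 0))) :=
  SmoothMapOn.ext (funext fun t => congrArg σ.ext' (vertexMap_zero α t))

lemma pathSimplex_vertex (γ : ℝ → G) (hγ : ContMDiff 𝓘(ℝ) I ∞ γ) (i : Fin 2) :
    (pathSimplex γ hγ).ext' (vertex 1 i) = γ i.val := by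
  refine ((pathSimplex γ hγ).ext'_apply ⟨_, vertex_mem i⟩).trans (congrArg γ ?_)
  fin_cases i <;> simp [vertex]

/-- Omitting v_0 leaves the vertex v_1, which is the parameter value 1; this is why the endpoint
carries the positive sign. -/
lemma boundary_pathSimplex (γ : ℝ → G) (hγ : ContMDiff 𝓘(ℝ) I ∞ γ) :
    boundary I G (chain (pathSimplex γ hγ)) =
      chain (pointSimplex I (γ 1)) - chain (pointSimplex I (γ 0)) := by
  have h : ∀ i : Fin 2, subface (pathSimplex γ hγ) (m := 0) i.succAbove =
      pointSimplex I (γ (i.succAbove (0 : Fin 1)).val) := fun i =>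
    (subface_vertex _ _).trans (congrArg _ (pathSimplex_vertex γ hγ _))
  rw [boundary, chain_lift]
  refine (Fin.sum_univ_two _).trans ?_
  rw [h, h]
  simp [sub_eq_add_neg]

/-! ### Products of points and paths; smooth dependence on parameters -/

section

variable [LieGroup I ∞ G]

lemma shuffleSimplex_toFun {r s : ℕ} (σ : Simplex I G r) (ν : Simplex I G s) (χ : Shuffle r s)
    (t : stdSimp (r + s)) : (shuffleSimplex σ ν χ).toFun t =
      σ.toFun ⟨_, coordMap_mem χ.2.1 t.2⟩ * ν.toFun ⟨_, coordMap_mem χ.2.2 t.2⟩ := by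
  have h1 := (σ.pull (coordMap fun i => χ.1 (Fin.castAdd s i)) (contDiff_coordMap _)
      (coordMap_mem χ.2.1)).ext'_apply t
  have h2 := (ν.pull (coordMap fun i => χ.1 (Fin.natAdd r i)) (contDiff_coordMap _)
      (coordMap_mem χ.2.2)).ext'_apply t
  refine (congrArg₂ (· * ·) h1 h2).trans (congrArg₂ (· * ·) ?_ ?_)
  · exact σ.ext'_apply ⟨_, coordMap_mem χ.2.1 t.2⟩
  · exact ν.ext'_apply ⟨_, coordMap_mem χ.2.2 t.2⟩

open Classical in
lemma chainMul_chain {r s : ℕ} (σ : Simplex I G r) (ν : Simplex I G s) :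
    chainMul I G (chain σ) (chain ν) =
      ∑ χ : Shuffle r s, ((Equiv.Perm.sign χ.1 : ℤ) : ℝ) • chain (shuffleSimplex σ ν χ) := by
  rw [chainMul, chain_lift, chain_lift]

/-- There is a single (0,1)-shuffle, the identity, so multiplying a path by a point is translation
with sign 1. -/
lemma chainMul_point_path (g : G) {γ : ℝ → G} (hγ : ContMDiff 𝓘(ℝ) I ∞ γ) :
    chainMul I G (chain (pointSimplex I g)) (chain (pathSimplex γ hγ)) =
      chain (pathSimplex (fun s => g * γ s) (contMDiff_const.mul hγ)) := by
  have : Subsingleton (Equiv.Perm (Fin (0 + 1))) := inferInstanceAs (Subsingleton (Equiv.Perm (Fin 1)))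
  let χ : Shuffle 0 1 := ⟨1, Subsingleton.strictMono _, Subsingleton.strictMono _⟩
  have h : shuffleSimplex (pointSimplex I g) (pathSimplex γ hγ) χ =
      pathSimplex (fun s => g * γ s) (contMDiff_const.mul hγ) :=
    SmoothMapOn.ext (funext fun t => shuffleSimplex_toFun _ _ χ t)
  rw [chainMul_chain, Fintype.sum_subsingleton _ χ, h]
  simp [χ]

lemma chainMul_path_point {γ : ℝ → G} (hγ : ContMDiff 𝓘(ℝ) I ∞ γ) (g : G) :
    chainMul I G (chain (pathSimplex γ hγ)) (chain (pointSimplex I g)) =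
      chain (pathSimplex (fun s => γ s * g) (hγ.mul contMDiff_const)) := by
  have : Subsingleton (Equiv.Perm (Fin (1 + 0))) := inferInstanceAs (Subsingleton (Equiv.Perm (Fin 1)))
  let χ : Shuffle 1 0 := ⟨1, Subsingleton.strictMono _, Subsingleton.strictMono _⟩
  have h : shuffleSimplex (pathSimplex γ hγ) (pointSimplex I g) χ =
      pathSimplex (fun s => γ s * g) (hγ.mul contMDiff_const) :=
    SmoothMapOn.ext (funext fun t => shuffleSimplex_toFun _ _ χ t)
  rw [chainMul_chain, Fintype.sum_subsingleton _ χ, h]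
  simp [χ]

/-- A module over the chains kills the product of two paths whose product takes values in a
curve. -/
lemma IsSmoothModule.act_path_mul_act_path {V : ChainAction I G} (hV : IsSmoothModule V)
    {γ δ ε : ℝ → G} (hγ : ContMDiff 𝓘(ℝ) I ∞ γ) (hδ : ContMDiff 𝓘(ℝ) I ∞ δ)
    (hε : ContMDiff 𝓘(ℝ) I ∞ ε) (a b : ℝ) (h : ∀ s t, γ s * δ t = ε (a * s + b * t)) :
    V.act (chain (pathSimplex γ hγ)) * V.act (chain (pathSimplex δ hδ)) = 0 := by
  rw [← hV.mul, chainMul_chain, map_sum]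
  refine Finset.sum_eq_zero fun χ _ => ?_
  rw [map_smul, hV.thin, smul_zero]
  -- For either shuffle the two coordinates enter only through the number `a s + b t`, so the
  -- 2-simplex factors through a line.
  refine isThin_of_factor (F := ℝ) (by simp) hε
    (l := fun t => a * t (χ.1 (Fin.castAdd 1 0)) + b * t (χ.1 (Fin.natAdd 1 0)))
    ((contDiff_const.mul (contDiff_apply ℝ ℝ _)).add (contDiff_const.mul (contDiff_apply ℝ ℝ _)))
    fun t => ?_
  rw [shuffleSimplex_toFun]
  exact h _ _

/-- The action on a smooth family of simplices depends smoothly on the parameter. -/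
lemma IsSmoothModule.contDiff_act {V : ChainAction I G} (hV : IsSmoothModule V) {N : Type*}
    [NormedAddCommGroup N] [NormedSpace ℝ N] [FiniteDimensional ℝ N] {k : ℕ}
    (s : N → Simplex I G k) {Φ : N × (Fin k → ℝ) → G} (hΦ : ContMDiff 𝓘(ℝ, N × (Fin k → ℝ)) I ∞ Φ)
    (h : ∀ p, ∀ t : stdSimp k, (s p).toFun t = Φ (p, t)) (f : Module.Dual ℝ V.cpx.carrier)
    (v : V.cpx.carrier) : ContDiff ℝ ∞ fun p => f (V.act (chain (s p)) v) := by
  -- The smoothness axiom speaks of manifolds in `Type` modelled on Euclidean space, so the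
  -- parameter space is replaced by the Euclidean space of its dimension.
  let e := toEuclidean (E := N)
  have h1 := hV.smooth (Module.finrank ℝ N) (EuclideanSpace ℝ (Fin (Module.finrank ℝ N))) k
    (fun p => s (e.symm p)) (by
      have h3 := (hΦ.comp ((e.symm.contDiff.contMDiff.comp contMDiff_fst).prodMk_space
        (contMDiff_snd (I := 𝓡 (Module.finrank ℝ N))
          (J := 𝓘(ℝ, Fin k → ℝ))))).contMDiffOn (s := univ ×ˢ stdSimp k)
      exact h3.congr fun q hq => ((s (e.symm q.1)).ext'_apply ⟨q.2, hq.2⟩).trans (h _ ⟨q.2, hq.2⟩))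
    f v
  simpa [Function.comp_def] using h1.contDiff.comp e.contDiff

/-- The action on a smooth family of paths depends smoothly on the parameter. -/
lemma IsSmoothModule.contDiff_act_path {V : ChainAction I G} (hV : IsSmoothModule V) {N : Type*}
    [NormedAddCommGroup N] [NormedSpace ℝ N] [FiniteDimensional ℝ N] {Φ : N → ℝ → G}
    (hΦ : ContMDiff 𝓘(ℝ, N × ℝ) I ∞ fun q : N × ℝ => Φ q.1 q.2)
    (hΦ' : ∀ p, ContMDiff 𝓘(ℝ) I ∞ (Φ p)) (f : Module.Dual ℝ V.cpx.carrier)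
    (v : V.cpx.carrier) : ContDiff ℝ ∞ fun p => f (V.act (chain (pathSimplex (Φ p) (hΦ' p))) v) :=
  hV.contDiff_act _ (Φ := fun q => Φ q.1 (q.2 0)) (hΦ.comp (contDiff_fst.prodMk
    ((contDiff_apply ℝ ℝ (0 : Fin 1)).comp contDiff_snd)).contMDiff) (fun _ _ => rfl) f v

end

end

/-! ### Smooth curves and the differentiation of the action on paths -/

section

variable {E : Type*} [NormedAddCommGroup E] [NormedSpace ℝ E]

/-- Differentiation under the integral sign. The inner derivative contributes one more factor `s`;
allowing every power `s ^ k` makes the class of these integrals stable under differentiation. -/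
lemma hasDerivAt_integral_scale [CompleteSpace E] {g : ℝ → E} (hg : ContDiff ℝ 1 g) (k : ℕ)
    (t : ℝ) : HasDerivAt (fun t => ∫ s in (0 : ℝ)..1, s ^ k • g (t * s))
      (∫ s in (0 : ℝ)..1, s ^ (k + 1) • deriv g (t * s)) t := by
  have hg' : Continuous (deriv g) := hg.continuous_deriv le_rfl
  have hc : Continuous fun p : ℝ × ℝ => p.2 ^ (k + 1) • deriv g (p.1 * p.2) := by fun_prop
  -- The dominating constant is the maximum of the continuous integrand over parameters within 1 of
  -- `t` and `s` in [0, 1].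
  obtain ⟨C, hC⟩ := ((isCompact_closedBall t 1).prod (isCompact_Icc (a := (0 : ℝ)) (b := 1))).exists_bound_of_continuousOn
    hc.continuousOn
  have hc1 : ∀ x : ℝ, Continuous fun s : ℝ => s ^ k • g (x * s) := fun x =>
    (continuous_id.pow k).smul (hg.continuous.comp (continuous_const.mul continuous_id))
  have hc2 : Continuous fun s : ℝ => s ^ (k + 1) • deriv g (t * s) :=
    (continuous_id.pow _).smul (hg'.comp (continuous_const.mul continuous_id))
  refine (intervalIntegral.hasDerivAt_integral_of_dominated_loc_of_deriv_le
    (F := fun t s => s ^ k • g (t * s)) (F' := fun t s => s ^ (k + 1) • deriv g (t * s))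
    (bound := fun _ => C) (Metric.closedBall_mem_nhds t one_pos)
    (Filter.Eventually.of_forall fun x => (hc1 x).aestronglyMeasurable)
    ((hc1 t).intervalIntegrable _ _) hc2.aestronglyMeasurable
    (Filter.Eventually.of_forall fun s hs x hx => ?_) intervalIntegrable_const
    (Filter.Eventually.of_forall fun s _ x _ => ?_)).2
  · rw [uIoc_of_le zero_le_one] at hs
    exact hC (x, s) ⟨hx, hs.1.le, hs.2⟩
  · have h1 := ((hg.differentiable one_ne_zero (x * s)).hasDerivAt.scomp x
      ((hasDerivAt_id x).mul_const s)).const_smul (s ^ k)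
    simpa [smul_smul, pow_succ] using! h1

/-- Induction on the order of smoothness with `g` and `k` free: the derivative is the same integral
for `deriv g` and `k + 1`. -/
lemma contDiff_integral_scale [CompleteSpace E] {g : ℝ → E} (hg : ContDiff ℝ ∞ g) (k : ℕ) :
    ContDiff ℝ ∞ fun t => ∫ s in (0 : ℝ)..1, s ^ k • g (t * s) := by
  refine contDiff_infty.2 fun n => ?_
  induction n generalizing g k with
  | zero =>
    exact contDiff_zero.2 (continuous_iff_continuousAt.2 fun t =>
      (hasDerivAt_integral_scale (hg.of_le (by simp)) k t).continuousAt)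
  | succ n ih =>
    have h := hasDerivAt_integral_scale (hg.of_le (m := 1) (by simp)) k
    rw [Nat.cast_succ, contDiff_succ_iff_deriv]
    refine ⟨fun t => (h t).differentiableAt, by simp, ?_⟩
    rw [funext fun t => (h t).deriv]
    exact ih (contDiff_infty_iff_deriv.1 hg).2 (k + 1)

/-- Hadamard's lemma for smooth curves. -/
lemma exists_eq_smul_of_contDiff [CompleteSpace E] {g : ℝ → E} (hg : ContDiff ℝ ∞ g)
    (h0 : g 0 = 0) : ∃ r : ℝ → E, ContDiff ℝ ∞ r ∧ r 0 = deriv g 0 ∧ ∀ t, g t = t • r t := by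
  have hg' := contDiff_infty_iff_deriv.1 hg
  -- The quotient is `r t = ∫ g'(t s) ds` over [0, 1], the case `k = 0`; its value at 0 is visibly
  -- `g'(0)`.
  refine ⟨_, contDiff_integral_scale hg'.2 0, by simp, fun t => ?_⟩
  have h := intervalIntegral.integral_eq_sub_of_hasDerivAt (a := 0) (b := 1)
    (f := fun s => g (t * s)) (f' := fun s => t • deriv g (t * s)) (fun s _ => ?_)
    ((continuous_const.smul (hg'.2.continuous.comp
      (continuous_const.mul continuous_id))).intervalIntegrable _ _)
  · rw [intervalIntegral.integral_smul] at h
    simpa [h0] using h.symm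
  · simpa using! (hg'.1 (t * s)).hasDerivAt.scomp s ((hasDerivAt_id s).const_mul t)

/-- A smooth map into a given neighbourhood of `0` which is the identity near `0`. -/
lemma exists_contDiff_cutoff [FiniteDimensional ℝ E] {U : Set E} (hU : U ∈ nhds (0 : E)) :
    ∃ B : E → E, ContDiff ℝ ∞ B ∧ (∀ᶠ y in nhds 0, B y = y) ∧ ∀ y, B y ∈ U := by
  obtain ⟨ε, hε, h⟩ := Metric.mem_nhds_iff.1 hU
  let b : ContDiffBump (0 : E) := ⟨ε / 2, ε, by positivity, by linarith⟩
  -- Inside the ball of radius ε the bump only shrinks `y`, and outside it the product is 0, so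
  -- every value stays in the ball.
  refine ⟨fun y => b y • y, b.contDiff.smul contDiff_id, ?_, fun y => h ?_⟩
  · filter_upwards [b.eventuallyEq_one] with y hy
    simp [hy]
  · rw [mem_ball_zero_iff, norm_smul, Real.norm_eq_abs, abs_of_nonneg b.nonneg]
    rcases lt_or_ge (dist y 0) ε with h' | h'
    · rw [dist_zero_right] at h'
      exact (mul_le_of_le_one_left (norm_nonneg y) b.le_one).trans_lt h'
    · rw [b.zero_of_le_dist h', zero_mul]
      exact hε

variable {H : Type*} [TopologicalSpace H] {I : ModelWithCorners ℝ E H}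
  {G : Type*} [TopologicalSpace G] [ChartedSpace H G]

/-- Charts of boundaryless manifolds extend, near a point, to smooth maps on the model space. -/
lemma exists_contMDiff_parametrization [FiniteDimensional ℝ E] [I.Boundaryless] [IsManifold I ∞ G]
    (g : G) : ∃ ψ : E → G, ContMDiff 𝓘(ℝ, E) I ∞ ψ ∧
      ∀ᶠ y in nhds 0, ψ y = (extChartAt I g).symm (extChartAt I g g + y) := by
  have hU : {y : E | extChartAt I g g + y ∈ (extChartAt I g).target} ∈ nhds (0 : E) := by
    refine (continuous_const.add continuous_id).continuousAt.preimage_mem_nhds ?_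
    simpa using extChartAt_target_mem_nhds g
  obtain ⟨B, hB, hB0, hBU⟩ := exists_contDiff_cutoff hU
  -- After the cutoff the argument of the inverse chart never leaves its target, which makes the map
  -- smooth on all of `E`.
  refine ⟨fun y => (extChartAt I g).symm (extChartAt I g g + B y), ?_, ?_⟩
  · exact (contMDiffOn_extChartAt_symm g).comp_contMDiff (contDiff_const.add hB).contMDiff hBU
  · filter_upwards [hB0] with y hy
    rw [hy]

/-- Smooth curves are, near a point, the image of a smooth curve in the model space. -/
lemma exists_lift_curve [I.Boundaryless] [IsManifold I ∞ G] {g : G} {ψ : E → G}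
    (hψ : ∀ᶠ y in nhds 0, ψ y = (extChartAt I g).symm (extChartAt I g g + y)) {γ : ℝ → G}
    (hγ : ContMDiff 𝓘(ℝ) I ∞ γ) (h0 : γ 0 = g) :
    ∃ β : ℝ → E, ContDiff ℝ ∞ β ∧ β 0 = 0 ∧ deriv β 0 = deriv (extChartAt I g ∘ γ) 0 ∧
      ∀ᶠ t in nhds 0, γ t = ψ (β t) := by
  have hs : ∀ᶠ t in nhds (0 : ℝ), γ t ∈ (extChartAt I g).source :=
    hγ.continuous.continuousAt.preimage_mem_nhds (h0 ▸ extChartAt_source_mem_nhds _)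
  have hc : ContinuousAt (fun t => extChartAt I g (γ t) - extChartAt I g g) 0 :=
    ((continuousAt_extChartAt' (h0 ▸ mem_extChartAt_source _)).comp
      hγ.continuous.continuousAt).sub continuousAt_const
  have hψ' : ∀ᶠ t in nhds (0 : ℝ), ψ (extChartAt I g (γ t) - extChartAt I g g) =
      (extChartAt I g).symm (extChartAt I g g + (extChartAt I g (γ t) - extChartAt I g g)) :=
    hc.eventually (by simpa [h0] using hψ)
  -- Here time is cut off: `γ (B t)` stays in the chart domain for all `t`, and equals `γ t` near 0.
  obtain ⟨B, hB, hB0, hBU⟩ := exists_contDiff_cutoff hs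
  refine ⟨fun t => extChartAt I g (γ (B t)) - extChartAt I g g, ?_, ?_, ?_, ?_⟩
  · have h1 : ContMDiff 𝓘(ℝ) 𝓘(ℝ, E) ∞ fun t => extChartAt I g (γ (B t)) :=
      (contMDiffOn_extChartAt (I := I) (x := g)).comp_contMDiff (hγ.comp hB.contMDiff)
        fun t => by simpa using hBU t
    exact h1.contDiff.sub contDiff_const
  · simp [hB0.self_of_nhds, h0]
  · rw [deriv_sub_const]
    refine Filter.EventuallyEq.deriv_eq ?_
    filter_upwards [hB0] with t ht
    simp [ht]
  · filter_upwards [hB0, hs, hψ'] with t ht hst ht'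
    rw [ht, ht', add_sub_cancel, (extChartAt I g).left_inv hst]

lemma contMDiff_scale {γ : ℝ → G} (hγ : ContMDiff 𝓘(ℝ) I ∞ γ) (t : ℝ) :
    ContMDiff 𝓘(ℝ) I ∞ fun s => γ (t * s) :=
  hγ.comp (contDiff_const.mul contDiff_id).contMDiff

variable [Group G] [LieGroup I ∞ G]

/-- The infinitesimal action on paths: the derivative of the action on the paths `s ↦ γ (t s)`
depends only, and linearly, on the velocity of `γ`. -/
theorem IsSmoothModule.exists_pathDerivative [FiniteDimensional ℝ E] [I.Boundaryless]
    {V : ChainAction I G} (hV : IsSmoothModule V) :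
    ∃ α : E →ₗ[ℝ] Module.End ℝ V.cpx.carrier, ∀ (γ : ℝ → G) (hγ : ContMDiff 𝓘(ℝ) I ∞ γ),
      γ 0 = 1 → HasOpDerivAtZero
        (fun t => V.act (chain (pathSimplex (fun s => γ (t * s)) (contMDiff_scale hγ t))))
        (α (deriv (extChartAt I (1 : G) ∘ γ) 0)) := by
  have := FiniteDimensional.complete ℝ E
  obtain ⟨ψ, hψ, hψ'⟩ := exists_contMDiff_parametrization (I := I) (1 : G)
  have hl : ∀ y : E, ContMDiff 𝓘(ℝ) I ∞ fun s : ℝ => ψ (s • y) := fun y =>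
    hψ.comp (contDiff_id.smul contDiff_const).contMDiff
  -- Straight paths in the chart, parametrized by their end vector `y`. Being a differential in `y`,
  -- the map α below is linear.
  have hF := hV.contDiff_act_path (Φ := fun (y : E) s => ψ (s • y))
    (hψ.comp (contDiff_snd.smul contDiff_fst).contMDiff) hl
  obtain ⟨α, hα⟩ := exists_opFDeriv (y := (0 : E)) fun f v => (hF f v).differentiable (by simp) 0
  refine ⟨α, fun γ hγ h0 f v => ?_⟩
  obtain ⟨β, hβ, hβ0, hβ', hβγ⟩ := exists_lift_curve hψ' hγ h0
  obtain ⟨r, hr, hr0, hβr⟩ := exists_eq_smul_of_contDiff hβ hβ0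
  -- Two parameters separate the scale of the path from its bending: `q (t, t)` is the path `s ↦ γ
  -- (t s)` for small `t`, and `q (a, 0)` is a straight path.
  have hq := hV.contDiff_act_path (Φ := fun (p : ℝ × ℝ) s => ψ ((p.1 * s) • r (p.2 * s)))
    (hψ.comp (((contDiff_fst.fst.mul contDiff_snd).smul
      (hr.comp (contDiff_fst.snd.mul contDiff_snd)))).contMDiff)
    (fun p => hψ.comp ((contDiff_const.mul contDiff_id).smul
      (hr.comp (contDiff_const.mul contDiff_id))).contMDiff) f v
  set q : ℝ × ℝ → ℝ := fun p => f (V.act (chain (pathSimplex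
    (fun s => ψ ((p.1 * s) • r (p.2 * s))) _)) v) with hqdef
  have hq0 := (hq.differentiable (by simp) 0).hasFDerivAt
  -- With scale 0 the path is constant, whatever the bending.
  have h1 : fderiv ℝ q 0 (0, 1) = 0 := by
    have h2 : HasDerivAt (fun b : ℝ => q (0, b)) (fderiv ℝ q 0 (0, 1)) 0 :=
      HasFDerivAt.comp_hasDerivAt (f := fun b : ℝ => ((0, b) : ℝ × ℝ)) 0 hq0
        ((hasDerivAt_const 0 0).prodMk (hasDerivAt_id 0))
    have h3 : (fun b : ℝ => q (0, b)) = fun _ => q (0, 0) := by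
      funext b
      simp only [hqdef]
      congr 4
      exact pathSimplex_congr _ _ fun s _ => by simp
    rw [h3] at h2
    exact h2.unique (hasDerivAt_const _ _)
  -- Without bending the path is straight with end vector `a • r 0`, where α was defined.
  have h2 : fderiv ℝ q 0 (1, 0) = f (α (r 0) v) := by
    have h3 : HasDerivAt (fun a : ℝ => q (a, 0)) (fderiv ℝ q 0 (1, 0)) 0 :=
      HasFDerivAt.comp_hasDerivAt (f := fun a : ℝ => ((a, 0) : ℝ × ℝ)) 0 hq0
        ((hasDerivAt_id 0).prodMk (hasDerivAt_const 0 0))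
    have h4 : (fun a : ℝ => q (a, 0)) = fun a : ℝ =>
        f (V.act (chain (pathSimplex (fun s => ψ (s • a • r 0)) (hl _))) v) := by
      funext a
      simp only [hqdef]
      congr 4
      exact pathSimplex_congr _ _ fun s _ => by simp [smul_smul, mul_comm]
    have h5 := HasFDerivAt.comp_hasDerivAt (f := fun a : ℝ => a • r 0) 0
      (by simpa using ((hF f v).differentiable (by simp) 0).hasFDerivAt)
      ((hasDerivAt_id (0 : ℝ)).smul_const (r 0))
    rw [h4] at h3
    rw [h3.unique h5, hα, one_smul]
  have h3 : HasDerivAt (fun t : ℝ => q (t, t)) (fderiv ℝ q 0 (1, 1)) 0 :=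
    HasFDerivAt.comp_hasDerivAt (f := fun t : ℝ => ((t, t) : ℝ × ℝ)) 0 hq0
      ((hasDerivAt_id 0).prodMk (hasDerivAt_id 0))
  have h4 : fderiv ℝ q 0 (1, 1) = f (α (r 0) v) := by
    rw [show ((1, 1) : ℝ × ℝ) = (1, 0) + (0, 1) by simp, map_add, h1, h2, add_zero]
  rw [← hβ', ← hr0, ← h4]
  refine h3.congr_of_eventuallyEq ?_
  -- The lift describes γ only near 0; since `s ≤ 1`, all points `t * s` lie in that neighbourhood
  -- as soon as `t` does.
  obtain ⟨ε, hε, h⟩ := Metric.eventually_nhds_iff.1 hβγ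
  filter_upwards [Metric.ball_mem_nhds 0 hε] with t ht
  simp only [hqdef]
  congr 4
  refine pathSimplex_congr _ _ fun s hs => ?_
  rw [h, hβr]
  rw [Metric.mem_ball, dist_zero_right, Real.norm_eq_abs] at ht
  rw [dist_zero_right, norm_mul, Real.norm_eq_abs, Real.norm_eq_abs, abs_of_nonneg hs.1]
  exact (mul_le_of_le_one_right (abs_nonneg t) hs.2).trans_lt ht

end

/-! ### The exponential map and the Lie bracket in a chart -/

section

variable {E : Type*} [NormedAddCommGroup E] [NormedSpace ℝ E]
  {H : Type*} [TopologicalSpace H] {I : ModelWithCorners ℝ E H}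
  {G : Type*} [TopologicalSpace G] [ChartedSpace H G]

/-- Tangent vectors at `g` are by definition read in the preferred chart at `g`, so the coordinate
change in the derivative of the curve is the identity. -/
lemma hasDerivAt_extChartAt_of_isMIntegralCurve [IsManifold I 1 G] {γ : ℝ → G} {g : G}
    {v : (x : G) → TangentSpace I x} (hγ : IsMIntegralCurve γ v) (h0 : γ 0 = g) :
    HasDerivAt (fun t => extChartAt I g (γ t)) (v g : E) 0 := by
  subst h0
  have h := (hγ.isMIntegralCurveAt 0).eventually_hasDerivAt.self_of_nhds
  exact h.congr_deriv (tangentCoordChange_self (I := I) (v := v (γ 0)) (mem_extChartAt_source _))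

variable [Group G]

lemma mulInvariantVectorField_one (x : GroupLieAlgebra I G) :
    mulInvariantVectorField x (1 : G) = x := by
  have e : (fun z : G => 1 * z) = id := funext one_mul
  have h := congrArg (fun f : G → G => (show E →L[ℝ] E from mfderiv I I f 1) x) e
  refine Eq.trans ?_ (h.trans ?_)
  · rfl
  · exact congrArg (fun L : E →L[ℝ] E => L x) (mfderiv_id (I := I) (x := (1 : G)))

variable [LieGroup I ∞ G]

/-- Left translates of integral curves of left-invariant vector fields are integral curves. -/
lemma isMIntegralCurve_const_mul {x : GroupLieAlgebra I G} {γ : ℝ → G}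
    (hγ : IsMIntegralCurve γ (mulInvariantVectorField (I := I) x)) (g : G) :
    IsMIntegralCurve (fun t => g * γ t) (mulInvariantVectorField (I := I) x) := by
  intro t
  have h4 : HasMFDerivAt I I (g * ·) (γ t) (mfderiv I I (g * ·) (γ t)) :=
    ((contMDiff_mul_left (I := I) (n := ∞) (a := g)).mdifferentiable (by simp) (γ t)).hasMFDerivAt
  have h5 := h4.comp t (hγ t)
  -- Left invariance of the field: the chain rule for `(g γ(t)) z = g (γ(t) z)` at `z = 1`.
  have h6 : mulInvariantVectorField x (g * γ t) =
      mfderiv I I (g * ·) (γ t) (mulInvariantVectorField x (γ t)) := by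
    have e : (fun z : G => g * γ t * z) = (g * ·) ∘ (γ t * ·) := by
      ext z
      simp [mul_assoc]
    have h7 := mfderiv_comp_apply (I := I) (I' := I) (I'' := I) (f := (γ t * ·)) (g := (g * ·))
      (x := (1 : G))
      ((contMDiff_mul_left (I := I) (n := ∞) (a := g)).mdifferentiable (by simp) _)
      ((contMDiff_mul_left (I := I) (n := ∞) (a := γ t)).mdifferentiable (by simp) 1) x
    have h8 := congrArg (fun f : G → G => (show E →L[ℝ] E from mfderiv I I f 1) x) e
    have h9 := congrArg (fun p : G => (show E →L[ℝ] E from mfderiv I I (g * ·) p)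
      (mulInvariantVectorField x (γ t))) (mul_one (γ t))
    exact h8.trans (h7.trans h9)
  refine h5.congr_mfderiv (ContinuousLinearMap.ext fun r => ?_)
  exact (map_smul (mfderiv I I (g * ·) (γ t)) (show ℝ from r) (mulInvariantVectorField x (γ t))).trans
    (congrArg (fun w : E => (show ℝ from r) • w) h6.symm)

/-! ### The one-parameter subgroup law -/

section

variable [CompleteSpace E] [I.Boundaryless] [T2Space G]

lemma isMIntegralCurve_lieExp (x : GroupLieAlgebra I G) :
    IsMIntegralCurve (fun t : ℝ => lieExp (t • x)) (mulInvariantVectorField (I := I) x) := by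
  simp only [lieExp_smul]
  exact (exists_oneParameter x).choose_spec.2

lemma lieExp_zero : lieExp (0 : GroupLieAlgebra I G) = 1 := by
  have h := lieExp_smul (0 : GroupLieAlgebra I G) 0
  rw [smul_zero] at h
  exact h.trans (exists_oneParameter 0).choose_spec.1

/-- As functions of `t`, both sides are integral curves of one left-invariant field, and both equal
`exp (s x)` at `t = 0`. -/
lemma lieExp_add_smul (x : GroupLieAlgebra I G) (s t : ℝ) :
    lieExp ((s + t) • x) = lieExp (s • x) * lieExp (t • x) := by
  have hv := (contMDiff_invariantField x).of_le (show (1 : ℕ∞ω) ≤ ∞ from ENat.LEInfty.out)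
  have h1 := (isMIntegralCurve_lieExp x).comp_add s
  have h2 := isMIntegralCurve_const_mul (isMIntegralCurve_lieExp x) (lieExp (s • x))
  have h := isMIntegralCurve_Ioo_eq_of_contMDiff_boundaryless (t₀ := 0) hv h1 h2
    (by simp [lieExp_zero])
  rw [add_comm]
  exact congrFun h t

lemma lieExp_neg_smul (x : GroupLieAlgebra I G) (s : ℝ) :
    lieExp (-s • x) = (lieExp (s • x))⁻¹ := by
  rw [eq_inv_iff_mul_eq_one, ← lieExp_add_smul, neg_add_cancel, zero_smul, lieExp_zero]

end

/-- A left-invariant vector field, read in the chart at `1`. -/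
def chartField (x : GroupLieAlgebra I G) : E → E :=
  VectorField.mpullbackWithin 𝓘(ℝ, E) I (extChartAt I (1 : G)).symm (mulInvariantVectorField x)
    (range I)

/-- The differentials of the chart and of its inverse are inverse to each other, so pulling back
along the inverse chart is pushing forward along the chart. The first form enters the Lie bracket,
the second is what velocities of curves compute. -/
lemma chartField_extChartAt (x : GroupLieAlgebra I G) {g : G}
    (hg : g ∈ (extChartAt I (1 : G)).source) : chartField x (extChartAt I (1 : G) g) =
      (mfderiv I 𝓘(ℝ, E) (extChartAt I (1 : G)) g : E →L[ℝ] E) (mulInvariantVectorField x g) := by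
  have : IsManifold I 1 G := IsManifold.of_le (n := ∞) (by simp)
  set φ := extChartAt I (1 : G) with hφ
  obtain ⟨z, hz, rfl⟩ : ∃ z ∈ φ.target, φ.symm z = g := ⟨φ g, φ.map_source hg, φ.left_inv hg⟩
  rw [φ.right_inv hz]
  have hinv := isInvertible_mfderivWithin_extChartAt_symm (I := I) (x := (1 : G)) hz
  have h1 := mfderiv_extChartAt_comp_mfderivWithin_extChartAt_symm (I := I) (x := (1 : G)) hz
  have h2 := mfderivWithin_extChartAt_symm_comp_mfderiv_extChartAt (I := I) (x := (1 : G)) hz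
  rw [chartField, VectorField.mpullbackWithin_apply, ContinuousLinearMap.inverse_eq h2 h1]

variable [CompleteSpace E] [I.Boundaryless]

lemma differentiableAt_chartField (x : GroupLieAlgebra I G) :
    DifferentiableAt ℝ (chartField x) (extChartAt I (1 : G) 1) := by
  have : IsManifold I 2 G := IsManifold.of_le (n := ∞) ENat.LEInfty.out
  have h := ((mdifferentiableAt_mulInvariantVectorField x
    (g := (1 : G))).mdifferentiableWithinAt
      (s := univ)).differentiableWithinAt_mpullbackWithin_vectorField
  rw [preimage_univ, univ_inter, I.range_eq_univ] at h
  rw [chartField, I.range_eq_univ]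
  exact DifferentiableWithinAt.differentiableAt (𝕜 := ℝ) (E := E) (F := E) h Filter.univ_mem

variable [T2Space G]

/-- The velocity of `t ↦ g exp (t x)` at `0`, in the chart at `1`. -/
lemma hasDerivAt_extChartAt_mul_lieExp (x : GroupLieAlgebra I G) {g : G}
    (hg : g ∈ (extChartAt I (1 : G)).source) :
    HasDerivAt (fun t : ℝ => extChartAt I (1 : G) (g * lieExp (t • x)))
      (chartField x (extChartAt I (1 : G) g)) 0 := by
  have : IsManifold I 1 G := IsManifold.of_le (n := ∞) (by simp)
  have h1 := isMIntegralCurve_const_mul (isMIntegralCurve_lieExp x) g 0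
  -- The curve passes through `g * exp 0`, which equals `g` but not by definition; the differential
  -- is taken there and moved to `g` at the end.
  have e : g * lieExp ((0 : ℝ) • x) = g := by rw [zero_smul, lieExp_zero, mul_one]
  have h2 : HasMFDerivAt I 𝓘(ℝ, E) (extChartAt I (1 : G)) (g * lieExp ((0 : ℝ) • x))
      (mfderiv I 𝓘(ℝ, E) (extChartAt I (1 : G)) (g * lieExp ((0 : ℝ) • x))) :=
    (mdifferentiableAt_extChartAt (by rw [e]; simpa using hg)).hasMFDerivAt
  have h4 := chartField_extChartAt x (g := g * lieExp ((0 : ℝ) • x)) (by rwa [e])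
  let L : E →L[ℝ] E := mfderiv I 𝓘(ℝ, E) (extChartAt I (1 : G)) (g * lieExp ((0 : ℝ) • x))
  let w : E := mulInvariantVectorField x (g * lieExp ((0 : ℝ) • x))
  have h3 : HasFDerivAt (fun t : ℝ => extChartAt I (1 : G) (g * lieExp (t • x)))
      (L.comp ((1 : ℝ →L[ℝ] ℝ).smulRight w)) 0 := (h2.comp (0 : ℝ) h1).hasFDerivAt
  refine h3.hasDerivAt.congr_deriv ?_
  have h5 : L.comp ((1 : ℝ →L[ℝ] ℝ).smulRight w) 1 = L w := by simp
  rw [h5, ← e]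
  simp only [e] at h4 ⊢
  exact h4.symm

/-- The velocity of `t ↦ exp (t x)` at `0`, in the chart at `1`. -/
lemma hasDerivAt_extChartAt_lieExp (x : GroupLieAlgebra I G) :
    HasDerivAt (fun t : ℝ => extChartAt I (1 : G) (lieExp (t • x))) (x : E) 0 := by
  have : IsManifold I 1 G := IsManifold.of_le (n := ∞) (by simp)
  have h := hasDerivAt_extChartAt_of_isMIntegralCurve (g := (1 : G)) (isMIntegralCurve_lieExp x)
    (by simp [lieExp_zero])
  rwa [mulInvariantVectorField_one] at h

/-- Both vectors are the velocity at 0 of `t ↦ exp (t x)` in the chart. -/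
lemma chartField_one (x : GroupLieAlgebra I G) :
    chartField x (extChartAt I (1 : G) 1) = x := by
  have h1 := hasDerivAt_extChartAt_mul_lieExp x (mem_extChartAt_source (1 : G))
  simp only [one_mul] at h1
  exact h1.unique (hasDerivAt_extChartAt_lieExp x)

/-- Every vector is the value at 1 of a left-invariant field, so `chartField_one` determines the
whole differential. It removes the transport factor from the bracket. -/
lemma mfderiv_extChartAt_one (x : E) :
    (mfderiv I 𝓘(ℝ, E) (extChartAt I (1 : G)) 1 : E →L[ℝ] E) x = x := by
  have h := chartField_extChartAt (I := I) (x : GroupLieAlgebra I G) (mem_extChartAt_source (1 : G))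
  refine Eq.trans ?_ (h.symm.trans (chartField_one x))
  exact congrArg (show E →L[ℝ] E from mfderiv I 𝓘(ℝ, E) (extChartAt I (1 : G)) 1)
    (mulInvariantVectorField_one (I := I) (x : GroupLieAlgebra I G)).symm

/-- The bracket of fields on a manifold is computed in the chart and carried back by the inverse of
the differential of the chart, here the identity. -/
lemma bracket_eq_chartField (x y : GroupLieAlgebra I G) :
    ⁅x, y⁆ = (fderiv ℝ (chartField y) (extChartAt I (1 : G) 1) x -
      fderiv ℝ (chartField x) (extChartAt I (1 : G) 1) y : E) := by
  have h := VectorField.mlieBracketWithin_apply (I := I) (V := mulInvariantVectorField x)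
    (W := mulInvariantVectorField y) (s := univ) (x₀ := (1 : G))
  rw [VectorField.mlieBracketWithin_univ, ← GroupLieAlgebra.bracket_def] at h
  let L : E →L[ℝ] E := mfderiv I 𝓘(ℝ, E) (extChartAt I (1 : G)) 1
  have e : L = ContinuousLinearMap.id ℝ E := ContinuousLinearMap.ext mfderiv_extChartAt_one
  have e' : L.inverse = ContinuousLinearMap.id ℝ E := by rw [e, ContinuousLinearMap.inverse_id]
  have h' := h.trans (congrArg (fun L : E →L[ℝ] E => L (VectorField.lieBracketWithin ℝ
    (chartField x) (chartField y) ((extChartAt I (1 : G)).symm ⁻¹' univ ∩ range I)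
    (extChartAt I (1 : G) 1))) e')
  refine h'.trans ?_
  rw [preimage_univ, univ_inter, I.range_eq_univ, VectorField.lieBracketWithin_univ,
    ContinuousLinearMap.id_apply, VectorField.lieBracket, chartField_one, chartField_one]

end

/-! ### The derivative of the adjoint action -/

section

variable {E : Type*} [NormedAddCommGroup E] [NormedSpace ℝ E]
  {H : Type*} [TopologicalSpace H] {I : ModelWithCorners ℝ E H}
  {G : Type*} [TopologicalSpace G] [ChartedSpace H G]
  [Group G] [LieGroup I ∞ G] [CompleteSpace E] [I.Boundaryless] [T2Space G]

/-- The derivative at `1` of the adjoint action is the Lie bracket. -/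
theorem hasDerivAt_conj_lieExp (x y : GroupLieAlgebra I G) :
    HasDerivAt (fun s : ℝ => deriv (fun t : ℝ => extChartAt I (1 : G)
      (lieExp (s • x) * lieExp (t • y) * (lieExp (s • x))⁻¹)) 0) (⁅x, y⁆ : GroupLieAlgebra I G) 0 := by
  set φ := extChartAt I (1 : G) with hφ
  -- The two occurrences of `exp (s x)` get independent parameters; conjugation is the restriction
  -- to `(s, t, -s)`. The derivative sought is a difference of two mixed second derivatives of Θ.
  let Θ : ℝ × ℝ × ℝ → E := fun p => φ (lieExp (p.1 • x) * lieExp (p.2.1 • y) * lieExp (p.2.2 • x))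
  have hm : ContMDiff 𝓘(ℝ, ℝ × ℝ × ℝ) I ∞ fun p : ℝ × ℝ × ℝ =>
      lieExp (p.1 • x) * lieExp (p.2.1 • y) * lieExp (p.2.2 • x) :=
    (((contMDiff_lieExp_smul x).comp contDiff_fst.contMDiff).mul
      ((contMDiff_lieExp_smul y).comp contDiff_snd.fst.contMDiff)).mul
      ((contMDiff_lieExp_smul x).comp contDiff_snd.snd.contMDiff)
  have hΘ : ∀ p : ℝ × ℝ × ℝ,
      lieExp (p.1 • x) * lieExp (p.2.1 • y) * lieExp (p.2.2 • x) ∈ φ.source →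
      ContDiffAt ℝ ∞ Θ p := fun p hp =>
    ((contMDiffAt_extChartAt' (by simpa [hφ] using hp)).comp p (hm p)).contDiffAt
  have hd : ∀ p : ℝ × ℝ × ℝ,
      lieExp (p.1 • x) * lieExp (p.2.1 • y) * lieExp (p.2.2 • x) ∈ φ.source →
      HasFDerivAt Θ (fderiv ℝ Θ p) p := fun p hp =>
    ((hΘ p hp).differentiableAt (by simp)).hasFDerivAt
  have h0 : ContDiffAt ℝ ∞ Θ 0 := hΘ 0 (by simp [lieExp_zero, hφ])
  have hT : HasFDerivAt (fderiv ℝ Θ) (fderiv ℝ (fderiv ℝ Θ) 0) 0 :=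
    ((h0.fderiv_right (m := 1)
      (show (1 + 1 : ℕ∞ω) ≤ ∞ by rw [one_add_one_eq_two]; exact ENat.LEInfty.out)).differentiableAt one_ne_zero).hasFDerivAt
  have hev : ∀ {f : ℝ → (ℝ × ℝ × ℝ →L[ℝ] E)} {f' : ℝ × ℝ × ℝ →L[ℝ] E} (_ : HasDerivAt f f' 0)
      (v : ℝ × ℝ × ℝ), HasDerivAt (fun s => f s v) (f' v) 0 := fun h v => by
    simpa using h.clm_apply (hasDerivAt_const 0 v)
  have he : ∀ z : GroupLieAlgebra I G, lieExp ((0 : ℝ) • z) = 1 := fun z => by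
    rw [zero_smul, lieExp_zero]
  set T := fderiv ℝ (fderiv ℝ Θ) 0 with hTdef
  -- Left-invariant fields describe multiplication on the right, so the rightmost varying factor
  -- must be differentiated first. For the last two parameters this requires exchanging the order.
  have hsymm := h0.isSymmSndFDerivAt (by simp; exact ENat.LEInfty.out) (0, 1, 0) (0, 0, 1)
  have hexp : ∀ z : GroupLieAlgebra I G, ∀ᶠ s : ℝ in nhds 0, lieExp (s • z) ∈ φ.source := fun z =>
    (contMDiff_lieExp_smul z).continuous.continuousAt.preimage_mem_nhds
      (by simpa [lieExp_zero, hφ] using extChartAt_source_mem_nhds (I := I) (1 : G))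
  have hchart : ∀ z w : GroupLieAlgebra I G,
      HasDerivAt (fun s : ℝ => chartField z (φ (lieExp (s • w))))
        (fderiv ℝ (chartField z) (φ 1) w) 0 := fun z w =>
    HasFDerivAt.comp_hasDerivAt (f := fun s : ℝ => φ (lieExp (s • w))) 0
      (by rw [he]; exact (differentiableAt_chartField z).hasFDerivAt)
      (hasDerivAt_extChartAt_lieExp w)
  -- The `t`-derivative of `exp (s x) exp (t y)` at 0 is the field of `y` at `exp (s x)`; then `s`
  -- is varied.
  have h1 : T (1, 0, 0) (0, 1, 0) = fderiv ℝ (chartField y) (φ 1) x := by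
    have h2 : HasDerivAt (fun s : ℝ => fderiv ℝ Θ (s, 0, 0) (0, 1, 0)) (T (1, 0, 0) (0, 1, 0)) 0 :=
      hev (HasFDerivAt.comp_hasDerivAt (f := fun s : ℝ => ((s, 0, 0) : ℝ × ℝ × ℝ)) 0 hT
        ((hasDerivAt_id 0).prodMk (hasDerivAt_const 0 0))) _
    refine h2.unique ((hchart y x).congr_of_eventuallyEq ?_)
    filter_upwards [hexp x] with s hs
    have h3 := HasFDerivAt.comp_hasDerivAt (f := fun t : ℝ => ((s, t, 0) : ℝ × ℝ × ℝ)) 0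
      (hd (s, 0, 0) (by simpa [lieExp_zero] using hs))
      ((hasDerivAt_const 0 s).prodMk ((hasDerivAt_id 0).prodMk (hasDerivAt_const 0 0)))
    refine h3.unique ?_
    simpa only [Θ, Function.comp_def, he, mul_one] using hasDerivAt_extChartAt_mul_lieExp y hs
  -- The same with `exp (t y) exp (u x)`: first `u`, which gives the field of `x` at `exp (t y)`,
  -- then `t`.
  have h2 : T (0, 1, 0) (0, 0, 1) = fderiv ℝ (chartField x) (φ 1) y := by
    have h2 : HasDerivAt (fun t : ℝ => fderiv ℝ Θ (0, t, 0) (0, 0, 1)) (T (0, 1, 0) (0, 0, 1)) 0 :=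
      hev (HasFDerivAt.comp_hasDerivAt (f := fun t : ℝ => ((0, t, 0) : ℝ × ℝ × ℝ)) 0 hT
        ((hasDerivAt_const 0 0).prodMk ((hasDerivAt_id 0).prodMk
          (hasDerivAt_const 0 0)))) _
    refine h2.unique ((hchart x y).congr_of_eventuallyEq ?_)
    filter_upwards [hexp y] with t ht
    have h3 := HasFDerivAt.comp_hasDerivAt (f := fun u : ℝ => ((0, t, u) : ℝ × ℝ × ℝ)) 0
      (hd (0, t, 0) (by simpa [lieExp_zero] using ht))
      ((hasDerivAt_const 0 0).prodMk ((hasDerivAt_const 0 t).prodMk (hasDerivAt_id 0)))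
    refine h3.unique ?_
    simpa only [Θ, Function.comp_def, he, one_mul] using hasDerivAt_extChartAt_mul_lieExp x ht
  have hc : ∀ s : ℝ, deriv (fun t : ℝ => φ (lieExp (s • x) * lieExp (t • y) * (lieExp (s • x))⁻¹)) 0
      = fderiv ℝ Θ (s, 0, -s) (0, 1, 0) := by
    intro s
    have h3 := HasFDerivAt.comp_hasDerivAt (f := fun t : ℝ => ((s, t, -s) : ℝ × ℝ × ℝ)) 0
      (hd (s, 0, -s) (by simp only [lieExp_neg_smul, he, mul_one, mul_inv_cancel]; exact mem_extChartAt_source _))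
      ((hasDerivAt_const 0 s).prodMk ((hasDerivAt_id 0).prodMk (hasDerivAt_const 0 (-s))))
    refine HasDerivAt.deriv ?_
    simpa only [Θ, Function.comp_def, lieExp_neg_smul] using h3
  have h3 : HasDerivAt (fun s : ℝ => fderiv ℝ Θ (s, 0, -s) (0, 1, 0))
      (T (1, 0, -1) (0, 1, 0)) 0 :=
    hev (HasFDerivAt.comp_hasDerivAt (f := fun s : ℝ => ((s, 0, -s) : ℝ × ℝ × ℝ)) 0
      (by rw [neg_zero]; exact hT) ((hasDerivAt_id 0).prodMk ((hasDerivAt_const 0 0).prodMk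
        (hasDerivAt_id 0).neg))) _
  simp only [hc]
  refine h3.congr_deriv ?_
  have e : ((1, 0, -1) : ℝ × ℝ × ℝ) = (1, 0, 0) - (0, 0, 1) := by simp
  rw [bracket_eq_chartField, e, map_sub, sub_apply, h1, ← hsymm, h2]

end

/-! ### The infinitesimal representation of a smooth module -/

section

variable {E : Type*} [NormedAddCommGroup E] [NormedSpace ℝ E]
  {H : Type*} [TopologicalSpace H] {I : ModelWithCorners ℝ E H}
  {G : Type*} [TopologicalSpace G] [ChartedSpace H G]
  [Group G] [LieGroup I ∞ G] [CompleteSpace E] [I.Boundaryless] [T2Space G]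

lemma expSimplex_eq (x : GroupLieAlgebra I G) :
    expSimplex x = pathSimplex (fun s => lieExp (s • x)) (contMDiff_lieExp_smul x) := rfl

lemma expSimplex_smul (t : ℝ) (x : GroupLieAlgebra I G) :
    expSimplex (t • x) = pathSimplex (fun s => lieExp ((t * s) • x))
      (contMDiff_scale (contMDiff_lieExp_smul x) t) :=
  pathSimplex_congr (contMDiff_lieExp_smul (t • x)) _ fun s _ => by rw [smul_smul, mul_comm]

variable {V : ChainAction I G}

/-- The derivatives of an action at paths through `1`, as a linear function of the velocity. -/
def IsPathDerivative (V : ChainAction I G)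
    (α : GroupLieAlgebra I G →ₗ[ℝ] Module.End ℝ V.cpx.carrier) : Prop :=
  ∀ (γ : ℝ → G) (hγ : ContMDiff 𝓘(ℝ) I ∞ γ), γ 0 = 1 → HasOpDerivAtZero
    (fun t => V.act (chain (pathSimplex (fun s => γ (t * s)) (contMDiff_scale hγ t))))
    (α (deriv (extChartAt I (1 : G) ∘ γ) 0 : E))

/-- The operator `[d, a] = d a + a d`. -/
def dBracket (X : FinComplex) : Module.End ℝ X.carrier →ₗ[ℝ] Module.End ℝ X.carrier :=
  LinearMap.mulLeft ℝ X.d + LinearMap.mulRight ℝ X.d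

lemma dBracket_apply (X : FinComplex) (a : Module.End ℝ X.carrier) :
    dBracket X a = X.d * a + a * X.d := rfl

/-- Both sides are `d a d` because `d² = 0`. -/
lemma d_mul_dBracket (X : FinComplex) (a : Module.End ℝ X.carrier) :
    X.d * dBracket X a = dBracket X a * X.d := by
  rw [dBracket_apply, mul_add, add_mul, ← mul_assoc, X.d_d, zero_mul, zero_add, mul_assoc a,
    X.d_d, mul_zero, add_zero, mul_assoc]

namespace IsPathDerivative

variable {α : GroupLieAlgebra I G →ₗ[ℝ] Module.End ℝ V.cpx.carrier}

lemma hasOpDeriv_expSimplex (hα : IsPathDerivative V α) (x : GroupLieAlgebra I G) :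
    HasOpDerivAtZero (fun t : ℝ => V.act (chain (expSimplex (t • x)))) (α x) := by
  have h := hα _ (contMDiff_lieExp_smul x) (by rw [zero_smul, lieExp_zero])
  have e : deriv (extChartAt I (1 : G) ∘ fun t : ℝ => lieExp (t • x)) 0 = x :=
    (hasDerivAt_extChartAt_lieExp x).deriv
  rw [e] at h
  exact h.congr fun t => by rw [expSimplex_smul]

/-- The DG module axiom for the boundary of σ[tx] reads `ρ(exp (t x)) = ρ(1) + d ρ(σ[tx]) + ρ(σ[tx])
d`, and the right side is differentiated term by term. -/
lemma hasOpDeriv_lieExp (hα : IsPathDerivative V α) (hV : IsSmoothModule V) (x : GroupLieAlgebra I G) :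
    HasOpDerivAtZero (fun t : ℝ => V.act (chain (pointSimplex I (lieExp (t • x)))))
      (dBracket V.cpx (α x)) := by
  have h := hα.hasOpDeriv_expSimplex x
  have h' := (HasOpDerivAtZero.const (V.act (chain (pointSimplex I (1 : G))))).add
    ((h.const_mul V.cpx.d).add (h.mul_const V.cpx.d))
  rw [zero_add] at h'
  refine h'.congr fun t => ?_
  have h1 := hV.differential 1 (expSimplex (t • x))
  rw [expSimplex_eq, boundary_pathSimplex, map_sub] at h1
  simp only [one_smul, zero_smul, lieExp_zero, pow_one, neg_smul, sub_neg_eq_add] at h1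
  rw [expSimplex_eq, ← h1, add_sub_cancel]

/-- The product `ρ(σ[ax]) ρ(σ[bx])` vanishes for all `a`, `b`, since `exp (a s x) exp (b t x)` stays
in a one-parameter subgroup. Differentiation in `b` and then in `a` gives the square. -/
lemma mul_self (hα : IsPathDerivative V α) (hV : IsSmoothModule V) (x : GroupLieAlgebra I G) : α x * α x = 0 := by
  have h := hα.hasOpDeriv_expSimplex x
  have h0 : ∀ a b : ℝ, V.act (chain (expSimplex (a • x))) * V.act (chain (expSimplex (b • x))) = 0 :=
    fun a b => hV.act_path_mul_act_path (contMDiff_lieExp_smul (a • x))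
      (contMDiff_lieExp_smul (b • x)) (contMDiff_lieExp_smul x) a b fun s t => by
      rw [smul_smul, smul_smul, ← lieExp_add_smul, mul_comm s, mul_comm t]
  have h1 : ∀ a : ℝ, V.act (chain (expSimplex (a • x))) * α x = 0 := fun a =>
    (h.const_mul _).unique ((HasOpDerivAtZero.const 0).congr (h0 a))
  exact (h.mul_const _).unique ((HasOpDerivAtZero.const 0).congr h1)

lemma anticomm (hα : IsPathDerivative V α) (hV : IsSmoothModule V) (x y : GroupLieAlgebra I G) :
    α x * α y + α y * α x = 0 := by
  have h := hα.mul_self hV (x + y)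
  rw [map_add, mul_add, add_mul, add_mul, hα.mul_self hV, hα.mul_self hV] at h
  simpa [add_comm] using h

/-- Conjugating the paths in `exp (t y)` by the point `exp (s x)` gives paths through 1 again. The
left side is the derivative of the conjugated operators, the right side is α at the new velocity.
The inverse is written `exp (s (-x))` so that it can be differentiated in `s`. -/
lemma conj (hα : IsPathDerivative V α) (hV : IsSmoothModule V) (x y : GroupLieAlgebra I G) (s : ℝ) :
    V.act (chain (pointSimplex I (lieExp (s • x)))) * α y *
      V.act (chain (pointSimplex I (lieExp (s • -x)))) =
    α (deriv (fun t : ℝ => extChartAt I (1 : G)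
      (lieExp (s • x) * lieExp (t • y) * (lieExp (s • x))⁻¹)) 0 : E) := by
  have h1 := hα (fun t : ℝ => lieExp (s • x) * lieExp (t • y) * (lieExp (s • x))⁻¹)
    ((contMDiff_const.mul (contMDiff_lieExp_smul y)).mul contMDiff_const)
    (by simp [lieExp_zero])
  refine HasOpDerivAtZero.unique ?_ h1
  refine (((hα.hasOpDeriv_expSimplex y).const_mul _).mul_const _).congr fun t => ?_
  rw [expSimplex_smul, ← hV.mul, chainMul_point_path, ← hV.mul, chainMul_path_point]
  simp only [smul_neg, ← neg_smul, lieExp_neg_smul]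

/-- The derivative of `conj` at `s = 0`: the Leibniz rule on one side, the derivative of the adjoint
action on the other. -/
lemma map_lie [FiniteDimensional ℝ E] (hα : IsPathDerivative V α) (hV : IsSmoothModule V) (x y : GroupLieAlgebra I G) :
    α ⁅x, y⁆ = dBracket V.cpx (α x) * α y - α y * dBracket V.cpx (α x) := by
  have h1 := ((hα.hasOpDeriv_lieExp hV x).mul_const (α y)).mul (hα.hasOpDeriv_lieExp hV (-x))
  simp only [zero_smul, lieExp_zero, hV.one, mul_one, one_mul, map_neg, mul_neg,
    ← sub_eq_add_neg] at h1
  refine HasOpDerivAtZero.unique (fun f v => ?_) (h1.congr fun s => (hα.conj hV x y s).symm)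
  -- Each coefficient of α is a linear functional on the finite-dimensional space `E`, hence
  -- continuous, and commutes with the derivative.
  let l : E →ₗ[ℝ] ℝ := f ∘ₗ LinearMap.applyₗ v ∘ₗ (show E →ₗ[ℝ] Module.End ℝ V.cpx.carrier from α)
  exact (LinearMap.toContinuousLinearMap l).hasFDerivAt.comp_hasDerivAt (0 : ℝ)
    (hasDerivAt_conj_lieExp x y)

/-- Apply `[d, -]` to `map_lie`: as `[d, α x]` commutes with `d`, only the factor `α y` is affected.
-/
lemma dBracket_map_lie [FiniteDimensional ℝ E] (hα : IsPathDerivative V α) (hV : IsSmoothModule V)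
    (x y : GroupLieAlgebra I G) : dBracket V.cpx (α ⁅x, y⁆) =
      dBracket V.cpx (α x) * dBracket V.cpx (α y) - dBracket V.cpx (α y) * dBracket V.cpx (α x) := by
  have h := d_mul_dBracket V.cpx (α x)
  rw [hα.map_lie hV, dBracket_apply V.cpx (_ - _), dBracket_apply V.cpx (α y)]
  generalize dBracket V.cpx (α x) = L at *
  simp only [mul_sub, sub_mul, mul_add, add_mul, ← mul_assoc, h]
  simp only [mul_assoc, h]
  abel

/-- The representation of `T𝔤` obtained by differentiation of a smooth module. -/
def rep [FiniteDimensional ℝ E] (hα : IsPathDerivative V α) (hV : IsSmoothModule V) :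
    DGLieRep (cartanAlg (GroupLieAlgebra I G)) V.cpx where
  act := α ∘ₗ LinearMap.fst ℝ _ _ + (dBracket V.cpx ∘ₗ α) ∘ₗ LinearMap.snd ℝ _ _
  act_mem p n x v hx hv := by
    rcases x with ⟨a, b⟩
    -- A homogeneous element is some L_b in degree 0, some i_a in degree -1, or zero.
    rcases mem_cartanGr.1 hx with ⟨rfl, h⟩ | ⟨rfl, h⟩ | h
    · obtain rfl : a = 0 := h
      have := (hα.hasOpDeriv_lieExp hV b).apply_mem fun t => hV.degree 0 _ n v hv
      simpa using this
    · obtain rfl : b = 0 := h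
      have := (hα.hasOpDeriv_expSimplex a).apply_mem fun t => hV.degree 1 _ n v hv
      simpa [sub_eq_add_neg] using this
    · rw [h, map_zero]
      exact zero_mem _
  act_bracket p q x y hx hy := by
    rcases x with ⟨a, b⟩
    rcases y with ⟨a', b'⟩
    rcases mem_cartanGr.1 hx with ⟨rfl, h⟩ | ⟨rfl, h⟩ | h
    · obtain rfl : a = 0 := h
      rcases mem_cartanGr.1 hy with ⟨rfl, h'⟩ | ⟨rfl, h'⟩ | h'
      · obtain rfl : a' = 0 := h'
        simpa using hα.dBracket_map_lie hV b b'
      · obtain rfl : b' = 0 := h'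
        simpa using hα.map_lie hV b a'
      · rw [h']
        simp
    · obtain rfl : b = 0 := h
      rcases mem_cartanGr.1 hy with ⟨rfl, h'⟩ | ⟨rfl, h'⟩ | h'
      · obtain rfl : a' = 0 := h'
        -- The bracket `[i, L]` is reduced to `[L, i]` by skew symmetry.
        have := hα.map_lie hV b' a
        rw [← lie_skew, map_neg, neg_eq_iff_eq_neg, neg_sub] at this
        simpa using this
      · obtain rfl : b' = 0 := h'
        -- In degrees -1 and -1 the graded commutator is the anticommutator.
        have := hα.anticomm hV a a'
        simpa using this.symm
      · rw [h']
        simp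
    · rw [h]
      simp
  act_d p x hx := by
    rcases x with ⟨a, b⟩
    rcases mem_cartanGr.1 hx with ⟨rfl, h⟩ | ⟨rfl, h⟩ | h
    · obtain rfl : a = 0 := h
      simp [d_mul_dBracket]
    · obtain rfl : b = 0 := h
      simp [dBracket_apply]
    · rw [h]
      simp

lemma isDerivative_rep [FiniteDimensional ℝ E] (hα : IsPathDerivative V α)
    (hV : IsSmoothModule V) : IsDerivative V (hα.rep hV) := fun x => by
  have e : (hα.rep hV).act (elemL x) = dBracket V.cpx (α x) := by simp [rep, elemL]
  have e' : (hα.rep hV).act (elemI x) = α x := by simp [rep, elemI]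
  rw [e, e']
  exact ⟨hα.hasOpDeriv_lieExp hV x, hα.hasOpDeriv_expSimplex x⟩

end IsPathDerivative

theorem IsSmoothModule.exists_isDerivative [FiniteDimensional ℝ E] (hV : IsSmoothModule V) :
    ∃ R : DGLieRep (cartanAlg (GroupLieAlgebra I G)) V.cpx, IsDerivative V R := by
  obtain ⟨α, hα⟩ := hV.exists_pathDerivative
  exact ⟨_, IsPathDerivative.isDerivative_rep (α := α) hα hV⟩

end

/-! ### Differentiation on the tensor closure -/

section

variable {E : Type*} [NormedAddCommGroup E] [NormedSpace ℝ E]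
  {H : Type*} [TopologicalSpace H] {I : ModelWithCorners ℝ E H}
  {G : Type*} [TopologicalSpace G] [ChartedSpace H G] [Group G]

/-- A 0-simplex is group-like for the coproduct. -/
lemma ChainAction.tensor_act_pointSimplex (V W : ChainAction I G) (g : G) :
    (V.tensor W).act (chain (pointSimplex I g)) = TensorProduct.map
      (V.act (chain (pointSimplex I g))) (W.act (chain (pointSimplex I g))) := by
  rw [tensor_act_chain, Fin.sum_univ_one]
  have h1 : front (pointSimplex I g) 0 = pointSimplex I g := subface_id _
  have h2 : back (pointSimplex I g) 0 = pointSimplex I g := subface_id _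
  have h3 : V.cpx.sgn (-((0 - (0 : Fin 1).val : ℕ) : ℤ)) = 1 := by simp [sgn_zero]
  rw [h3, h1, h2]
  rfl

/-- The coproduct of a path γ is `γ(0) ⊗ γ + γ ⊗ γ(1)`; in the first term the degree -1 chain passes
the vector of `V`, which produces `sgn (-1)`. -/
lemma ChainAction.tensor_act_pathSimplex (V W : ChainAction I G) (γ : ℝ → G)
    (hγ : ContMDiff 𝓘(ℝ) I ∞ γ) : (V.tensor W).act (chain (pathSimplex γ hγ)) =
      TensorProduct.map (V.act (chain (pointSimplex I (γ 0))) * V.cpx.sgn (-1))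
        (W.act (chain (pathSimplex γ hγ))) +
      TensorProduct.map (V.act (chain (pathSimplex γ hγ)))
        (W.act (chain (pointSimplex I (γ 1)))) := by
  rw [tensor_act_chain, Fin.sum_univ_two]
  have h1 : front (pathSimplex γ hγ) 0 = pointSimplex I (γ 0) :=
    (subface_vertex _ _).trans (congrArg _ ((pathSimplex_vertex γ hγ 0).trans (by simp)))
  have h2 : back (pathSimplex γ hγ) 0 = pathSimplex γ hγ := subface_id _
  have h3 : front (pathSimplex γ hγ) 1 = pathSimplex γ hγ := subface_id _
  have h4 : back (pathSimplex γ hγ) 1 = pointSimplex I (γ 1) :=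
    (subface_vertex _ _).trans (congrArg _ ((pathSimplex_vertex γ hγ 1).trans (by simp)))
  have h5 : V.cpx.sgn (-((1 - (1 : Fin 2).val : ℕ) : ℤ)) = 1 := by simp [sgn_zero]
  rw [h1, h2, h3, h4, h5]
  rfl

variable [LieGroup I ∞ G] [CompleteSpace E] [I.Boundaryless] [T2Space G]

namespace IsDerivative

variable {V W : ChainAction I G} {R R' : DGLieRep (cartanAlg (GroupLieAlgebra I G)) V.cpx}
  {S : DGLieRep (cartanAlg (GroupLieAlgebra I G)) W.cpx}

/-- Morphisms of complexes with an action are equivariant for the derivatives of the actions. -/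
lemma equivariant (hR : IsDerivative V R) (hS : IsDerivative W S) (φ : V ⟶ W)
    (x : (cartanAlg (GroupLieAlgebra I G)).carrier) :
    φ.hom.toLin ∘ₗ R.act x = S.act x ∘ₗ φ.hom.toLin := by
  obtain ⟨a, b⟩ := x
  have e : ((a, b) : GroupLieAlgebra I G × GroupLieAlgebra I G) = elemI a + elemL b := by
    simp [elemI, elemL]
  rw [e, map_add, map_add, LinearMap.comp_add, LinearMap.add_comp]
  exact congrArg₂ (· + ·)
    ((hR a).2.intertwine (hS a).2 fun t => φ.equivariant _)
    ((hR b).1.intertwine (hS b).1 fun t => φ.equivariant _)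

/-- The identity of `V` is equivariant from `R` to `R'`. Hence any two constructions that
differentiate the same action agree as representations. -/
lemma unique (hR : IsDerivative V R) (hR' : IsDerivative V R') : R = R' :=
  DGLieRep.ext (LinearMap.ext fun x => hR.equivariant hR' (𝟙 V) x)

/-- Under the counit all points act by 1 and all paths by 0, so both curves of operators are
constant. -/
lemma unit : IsDerivative (ChainAction.unit (I := I) (G := G)) DGLieRep.trivial := fun x => by
  refine ⟨(HasOpDerivAtZero.const 1).congr fun t => ?_, (HasOpDerivAtZero.const 0).congr fun t => ?_⟩
  · exact LinearMap.ext fun u => (ChainAction.unit_act_apply _ u).trans (if_pos rfl)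
  · exact LinearMap.ext fun u => (ChainAction.unit_act_apply _ u).trans (if_neg one_ne_zero)

/-- The Leibniz rule applied to the coproducts of points and paths; the hypotheses supply the values
at `t = 0` of the factors that are not differentiated. -/
lemma tensor (hR : IsDerivative V R) (hS : IsDerivative W S)
    (hV : V.act (chain (pointSimplex I (1 : G))) = 1)
    (hW : W.act (chain (pointSimplex I (1 : G))) = 1)
    (hV' : V.act (chain (expSimplex (I := I) (G := G) 0)) = 0) :
    IsDerivative (V.tensor W) (R.tensor S) := fun x => by
  constructor
  · have h := (hR x).1.map (hS x).1
    simp only [zero_smul, lieExp_zero, hV, hW] at h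
    have e : (R.tensor S).act (elemL x) =
        TensorProduct.map (R.act (elemL x)) 1 + TensorProduct.map 1 (S.act (elemL x)) := by
      refine (DGLieRep.tensorAct_of_mem R S (p := 0) (mem_cartanGr.2 (by simp [elemL]))).trans ?_
      rw [ChainAction.sgn_zero]
      rfl
    rw [e]
    exact h.congr fun t => ChainAction.tensor_act_pointSimplex V W _
  · have h := ((HasOpDerivAtZero.const (V.cpx.sgn (-1))).map (hS x).2).add
      ((hR x).2.map (hS x).1)
    -- The moving endpoint `exp (t x)` contributes its derivative times the action of the constant
    -- path, which is zero; no L_x term survives.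
    simp only [zero_smul, lieExp_zero, hV', hW, TensorProduct.map_zero_left, zero_add,
      add_zero] at h
    have e : (R.tensor S).act (elemI x) =
        TensorProduct.map (V.cpx.sgn (-1)) (S.act (elemI x)) +
          TensorProduct.map (R.act (elemI x)) 1 := by
      refine (DGLieRep.tensorAct_of_mem R S (p := -1) (mem_cartanGr.2 (by simp [elemI]))).trans ?_
      exact add_comm _ _
    rw [e]
    refine h.congr fun t => ?_
    have h1 := ChainAction.tensor_act_pathSimplex V W _ (contMDiff_lieExp_smul (t • x))
    rw [zero_smul, one_smul, lieExp_zero, hV, one_mul] at h1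
    exact h1

end IsDerivative

variable [FiniteDimensional ℝ E]

/-- Tensor products are not shown to be smooth modules again, so the induction carries just what
`IsDerivative.tensor` consumes: a derivative, the unit acting as identity, and the constant path at
1 acting by zero. -/
lemma IsTensorGenerated.exists_isDerivative_and {V : ChainAction I G} (hV : IsTensorGenerated V) :
    (∃ R : DGLieRep (cartanAlg (GroupLieAlgebra I G)) V.cpx, IsDerivative V R) ∧
      V.act (chain (pointSimplex I (1 : G))) = 1 ∧
      V.act (chain (expSimplex (I := I) (G := G) 0)) = 0 := by
  induction hV with
  | of_smooth V hV =>
    refine ⟨hV.exists_isDerivative, hV.one, hV.thin _ _ ?_⟩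
    have h : expSimplex (I := I) (G := G) 0 = pathSimplex (fun _ => 1) contMDiff_const :=
      pathSimplex_congr (contMDiff_lieExp_smul 0) _ fun s _ => by rw [smul_zero, lieExp_zero]
    rw [h]
    exact isThin_pathSimplex_const 1
  | unit =>
    exact ⟨⟨_, IsDerivative.unit⟩,
      LinearMap.ext fun u => (ChainAction.unit_act_apply _ u).trans (if_pos rfl),
      LinearMap.ext fun u => (ChainAction.unit_act_apply _ u).trans (if_neg one_ne_zero)⟩
  | tensor V W _ _ hV hW =>
    obtain ⟨⟨R, hR⟩, hV1, hV0⟩ := hV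
    obtain ⟨⟨S, hS⟩, hW1, hW0⟩ := hW
    refine ⟨⟨_, hR.tensor hS hV1 hW1 hV0⟩, ?_, ?_⟩
    · rw [ChainAction.tensor_act_pointSimplex, hV1, hW1]
      exact TensorProduct.map_id
    · have h := ChainAction.tensor_act_pathSimplex V W _
        (contMDiff_lieExp_smul (0 : GroupLieAlgebra I G))
      rw [← expSimplex_eq, hV0, hW0, TensorProduct.map_zero_left, TensorProduct.map_zero_right,
        add_zero] at h
      exact h

/-- The derivative of an action in the tensor closure. -/
def infinitesimalRep (V : (tensorClosure I G).FullSubcategory) :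
    DGLieRep (cartanAlg (GroupLieAlgebra I G)) V.obj.cpx :=
  (IsTensorGenerated.exists_isDerivative_and V.property).1.choose

lemma isDerivative_infinitesimalRep (V : (tensorClosure I G).FullSubcategory) :
    IsDerivative V.obj (infinitesimalRep V) :=
  (IsTensorGenerated.exists_isDerivative_and V.property).1.choose_spec

lemma infinitesimalRep_equivariant (V W : (tensorClosure I G).FullSubcategory) (φ : V ⟶ W)
    (x : (cartanAlg (GroupLieAlgebra I G)).carrier) :
    φ.hom.hom.toLin ∘ₗ (infinitesimalRep V).act x = (infinitesimalRep W).act x ∘ₗ φ.hom.hom.toLin :=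
  (isDerivative_infinitesimalRep V).equivariant (isDerivative_infinitesimalRep W) φ.hom x

open MonoidalCategory

lemma infinitesimalRep_unit :
    infinitesimalRep (𝟙_ (tensorClosure I G).FullSubcategory) = DGLieRep.trivial :=
  (isDerivative_infinitesimalRep (𝟙_ (tensorClosure I G).FullSubcategory)).unique IsDerivative.unit

/-- Both sides differentiate the action on V ⊗ W. The left side is an arbitrary choice, pinned down
by `IsDerivative.unique`. -/
lemma infinitesimalRep_tensor (V W : (tensorClosure I G).FullSubcategory) :
    infinitesimalRep (V ⊗ W) = (infinitesimalRep V).tensor (infinitesimalRep W) := by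
  obtain ⟨-, hV, hV'⟩ := IsTensorGenerated.exists_isDerivative_and V.property
  obtain ⟨-, hW, -⟩ := IsTensorGenerated.exists_isDerivative_and W.property
  exact (isDerivative_infinitesimalRep (V ⊗ W)).unique
    ((isDerivative_infinitesimalRep V).tensor (isDerivative_infinitesimalRep W) hV hW hV')

variable (I G) in
/-- Differentiation is strong monoidal, with identities as structure isomorphisms. -/
def coreMonoidalInfinitesimalRep :
    (repFunctor (tensorClosure I G) infinitesimalRep infinitesimalRep_equivariant).CoreMonoidal where
  -- Source and target have the same complex and representations that are equal, though not by
  -- definition; the identity of the complex is therefore an isomorphism. The same holds for `μIso`,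
  -- and the coherence conditions reduce to definitional equalities on pure tensors.
  εIso := Rep.isoMk (V := ⟨FinComplex.unit, DGLieRep.trivial⟩)
    (W := ⟨FinComplex.unit, infinitesimalRep (𝟙_ (tensorClosure I G).FullSubcategory)⟩) (.refl _)
    fun x => by rw [infinitesimalRep_unit]; rfl
  μIso V W := Rep.isoMk
    (V := ⟨V.obj.cpx.tensor W.obj.cpx, (infinitesimalRep V).tensor (infinitesimalRep W)⟩)
    (W := ⟨V.obj.cpx.tensor W.obj.cpx, infinitesimalRep (V ⊗ W)⟩) (.refl _)
    fun x => by rw [infinitesimalRep_tensor]; rfl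
  μIso_hom_natural_left f W := by
    ext1; ext1; exact TensorProduct.ext rfl
  μIso_hom_natural_right V f := by
    ext1; ext1; exact TensorProduct.ext rfl
  associativity U V W := by
    ext1; ext1; exact TensorProduct.ext (TensorProduct.ext rfl)
  left_unitality V := by
    ext1; ext1; exact TensorProduct.ext rfl
  right_unitality V := by
    ext1; ext1; exact TensorProduct.ext rfl

end

end LieChains
end

/-! ### The main theorem -/

theorem mainTheorem3 {E : Type*} [NormedAddCommGroup E] [NormedSpace ℝ E]
    [FiniteDimensional ℝ E] [CompleteSpace E]
    {H : Type*} [TopologicalSpace H] (I : ModelWithCorners ℝ E H) [I.Boundaryless]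
    (G : Type*) [TopologicalSpace G] [ChartedSpace H G] [Group G] [LieGroup I ∞ G] [T2Space G] :
    ∃ (R : ∀ V : (smoothModules I G).FullSubcategory,
          DGLieRep (cartanAlg (GroupLieAlgebra I G)) V.obj.cpx)
        (hR : ∀ (V W : (smoothModules I G).FullSubcategory) (φ : V ⟶ W) x,
          φ.hom.hom.toLin ∘ₗ (R V).act x = (R W).act x ∘ₗ φ.hom.hom.toLin),
      (∀ V, IsDerivative V.obj (R V)) ∧
      ∃ (R' : ∀ V : (tensorClosure I G).FullSubcategory,
            DGLieRep (cartanAlg (GroupLieAlgebra I G)) V.obj.cpx)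
          (hR' : ∀ (V W : (tensorClosure I G).FullSubcategory) (φ : V ⟶ W) x,
            φ.hom.hom.toLin ∘ₗ (R' V).act x = (R' W).act x ∘ₗ φ.hom.hom.toLin),
        (∀ V, IsDerivative V.obj (R' V)) ∧
        ObjectProperty.ιOfLE smoothModules_le_tensorClosure ⋙ repFunctor _ R' hR' =
          repFunctor _ R hR ∧
        ∃ m : (repFunctor _ R' hR').Monoidal,
          m.ε.hom.toLin = (LinearMap.id : ℝ →ₗ[ℝ] ℝ) ∧
          ∀ V W : (tensorClosure I G).FullSubcategory, (m.μ V W).hom.toLin =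
            (LinearMap.id : (V.obj.cpx.tensor W.obj.cpx).carrier →ₗ[ℝ] _) := by
  -- On smooth modules the representation chosen is the one of the tensor closure, so the
  -- restriction of the large functor is the small one by definition.
  refine ⟨fun V => infinitesimalRep ⟨V.obj, smoothModules_le_tensorClosure _ V.property⟩,
    fun V W φ x => IsDerivative.equivariant (isDerivative_infinitesimalRep
      ⟨V.obj, smoothModules_le_tensorClosure _ V.property⟩) (isDerivative_infinitesimalRep
      ⟨W.obj, smoothModules_le_tensorClosure _ W.property⟩) φ.hom x,
    fun V => isDerivative_infinitesimalRep ⟨V.obj, smoothModules_le_tensorClosure _ V.property⟩,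
    infinitesimalRep, infinitesimalRep_equivariant,
    isDerivative_infinitesimalRep, rfl, (coreMonoidalInfinitesimalRep I G).toMonoidal, rfl,
    fun V W => rfl⟩
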